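/- Let $\bar a=(a_1,\dots,a_m)$ and $\bar b=(b_1,\dots,b_l)$ be compositions of $n$, and let $\mathfrak q=\mathfrak q(\bar a|\bar b)\subset\mathfrak{gl}_n(\mathbb C)$ be the seaweed subalgebra they define, i.e. the intersection of the block upper triangular matrices for $\bar a$ with the block lower triangular matrices for $\bar b$. Let $Q\subset GL_n(\mathbb C)$ be the connected algebraic group with Lie algebra $\mathfrak q$ (the group of invertible elements of $\mathfrak q$) and $Z$ its centre. **Maximal reductive stabilisers.** For $\gamma\in\mathfrak q^*$ let $Q_\gamma$ be its stabiliser in $Q$ for the coadjoint action and $\mathfrak q_\gamma=\{x\in\mathfrak q\mid\gamma([x,\mathfrak q])=0\}$. The form $\gamma$ is of reductive type if $Q_\gamma/Z$ is a reductive subgroup of $GL(\mathfrak q)$. The algebra $\mathfrak q$ is strongly quasi-reductive if there is a form of reductive type and the centre of $\mathfrak q$ consists of semisimple elements. In this case a subgroup $H\subset Q$ is called a maximal reductive stabiliser (MRS) of $\mathfrak q$ if $H=Q_\gamma$ for some $\gamma$ of reductive type with $\gamma(\mathfrak q_\gamma)=0$. **Meander graph.** $\Gamma(\bar a|\bar b)$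 has vertices $1,\dots,n$. For each block $[s+1,s+a_k]$, $s=a_1+\dots+a_{k-1}$, of $\bar a$, it has the edges joining $s+j$ with $s+a_k+1-j$ (when these differ), and similarly for each block of $\bar b$; an $\bar a$-edge and a $\bar b$-edge with the same ends are two edges. Its connected components are cycles (all vertices of valency $2$; a double edge is a cycle) and segments (possibly a single vertex). A component with vertices $x_1>\dots>x_t$ lies inside a cycle with vertices $y_1>\dots>y_s$ if $y_{2i}<x_1<y_{2i-1}$ for some $i$. The dimension of a cycle is $2\cdot\#(\text{cycles inside it})+\#(\text{segments inside it})+2$; the dimension of a segment is $1$. A maximal cycle is a component, cycle or segment, that lies inside no cycle. **Theorem.** If a maximal cycle $X$ with vertices $x_1>\dots>x_t$ and dimension $r$ is a cycle, then $t$ is even and $x_{2i-1}-x_{2i}=r-1$ for all $i$. To $X$ attach the subgroup of $GL_n(\mathbb C)$ isomorphic to $GL_r(\mathbb C)$ embedded as follows: if $X$ is a cycle, $g\in GL_r(\mathbb C)$ goes to the matrix whose diagonal block in rows and columns $[x_{2i},x_{2i-1}]$ is $g$ for every $i$, with all other entries those of the identity matrix; if $X$ is a segment, $c\in GL_1(\mathbb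 C)$ goes to the diagonal matrix with $c$ in places $x_1,\dots,x_t$ and $1$ in the other places. These subgroups, for all maximal cycles $X$ of $\Gamma(\bar a|\bar b)$, commute with each other, their product in $GL_n(\mathbb C)$ is direct, and this product is a maximal reductive stabiliser of $\mathfrak q$. In particular, this maximal reductive stabiliser is connected. -/

import Mathlib

namespace SeaweedMRS

open Matrix

-- The commutator bracket on an associative ring.
attribute [local instance 100] LieRing.ofAssociativeRing

/-! ### Seaweed subalgebras of `gl_n` and their groups -/

/-- The seaweed subalgebra `q(a|b)` of `gl_n(ℂ)`: the intersection of the parabolic subalgebra of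
block upper triangular matrices for the composition `a` with the parabolic subalgebra of block
lower triangular matrices for the composition `b`. -/
def seaweed {n : ℕ} (a b : Composition n) : LieSubalgebra ℂ (Matrix (Fin n) (Fin n) ℂ) where
  carrier := {M | ∀ i j, M i j ≠ 0 → a.index i ≤ a.index j ∧ b.index j ≤ b.index i}
  add_mem' := by
    intro M N hM hN i j h
    by_cases h1 : M i j = 0
    · refine hN i j fun h2 => h ?_
      simp [h1, h2]
    · exact hM i j h1
  zero_mem' := by
    intro i j h
    exact absurd rfl h
  smul_mem' := by
    intro c M hM i j h
    refine hM i j fun h1 => h ?_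
    simp [h1]
  lie_mem' := by
    have key : ∀ M N : Matrix (Fin n) (Fin n) ℂ,
        (∀ i j, M i j ≠ 0 → a.index i ≤ a.index j ∧ b.index j ≤ b.index i) →
        (∀ i j, N i j ≠ 0 → a.index i ≤ a.index j ∧ b.index j ≤ b.index i) →
        ∀ i j, (M * N) i j ≠ 0 → a.index i ≤ a.index j ∧ b.index j ≤ b.index i := by
      intro M N hM hN i j h
      rw [Matrix.mul_apply] at h
      obtain ⟨k, -, hk⟩ := Finset.exists_ne_zero_of_sum_ne_zero h
      have h1 := hM i k (left_ne_zero_of_mul hk)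
      have h2 := hN k j (right_ne_zero_of_mul hk)
      exact ⟨h1.1.trans h2.1, h2.2.trans h1.2⟩
    intro M N hM hN i j h
    rw [Ring.lie_def, Matrix.sub_apply] at h
    by_cases h1 : (M * N) i j = 0
    · refine key N M hN hM i j fun h2 => h ?_
      simp [h1, h2]
    · exact key M N hM hN i j h1

theorem mul_mem_seaweed {n : ℕ} {a b : Composition n} {M N : Matrix (Fin n) (Fin n) ℂ}
    (hM : M ∈ seaweed a b) (hN : N ∈ seaweed a b) : M * N ∈ seaweed a b := by
  intro i j h
  rw [Matrix.mul_apply] at h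
  obtain ⟨k, -, hk⟩ := Finset.exists_ne_zero_of_sum_ne_zero h
  have h1 := hM i k (left_ne_zero_of_mul hk)
  have h2 := hN k j (right_ne_zero_of_mul hk)
  exact ⟨h1.1.trans h2.1, h2.2.trans h1.2⟩

theorem one_mem_seaweed {n : ℕ} {a b : Composition n} :
    (1 : Matrix (Fin n) (Fin n) ℂ) ∈ seaweed a b := by
  intro i j h
  have hij : i = j := by
    by_contra h1
    exact h (Matrix.one_apply_ne h1)
  subst hij
  exact ⟨le_rfl, le_rfl⟩

/-- The connected algebraic subgroup `Q` of `GL_n(ℂ)` with Lie algebra `q(a|b)`. As `q(a|b)` is an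
associative subalgebra of the matrix algebra, `Q` is its group of units, that is, the
(Zariski open, dense) set of invertible elements of the vector space `q(a|b)`. -/
def seaweedGroup {n : ℕ} (a b : Composition n) : Subgroup (GL (Fin n) ℂ) where
  carrier := {g | (g : Matrix (Fin n) (Fin n) ℂ) ∈ seaweed a b ∧
    ((g⁻¹ : GL (Fin n) ℂ) : Matrix (Fin n) (Fin n) ℂ) ∈ seaweed a b}
  mul_mem' := by
    intro g h hg hh
    refine ⟨?_, ?_⟩
    · rw [Units.val_mul]
      exact mul_mem_seaweed hg.1 hh.1
    · rw [_root_.mul_inv_rev, Units.val_mul]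
      exact mul_mem_seaweed hh.2 hg.2
  one_mem' := by
    refine ⟨?_, ?_⟩
    · rw [Units.val_one]
      exact one_mem_seaweed
    · rw [inv_one, Units.val_one]
      exact one_mem_seaweed
  inv_mem' := by
    intro g hg
    refine ⟨hg.2, ?_⟩
    rw [inv_inv]
    exact hg.1

/-- The linear map `x ↦ g x g⁻¹` of `q(a|b)`, for `g` in `Q`. -/
def conjMap {n : ℕ} (a b : Composition n) (g : seaweedGroup a b) :
    seaweed a b →ₗ[ℂ] seaweed a b where
  toFun x := ⟨((g : GL (Fin n) ℂ) : Matrix (Fin n) (Fin n) ℂ) * (x : Matrix (Fin n) (Fin n) ℂ) *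
      (((g : GL (Fin n) ℂ)⁻¹ : GL (Fin n) ℂ) : Matrix (Fin n) (Fin n) ℂ),
    mul_mem_seaweed (mul_mem_seaweed g.2.1 x.2) g.2.2⟩
  map_add' x y := by
    apply Subtype.ext
    simp [mul_add, add_mul]
  map_smul' c x := by
    apply Subtype.ext
    simp

theorem conjMap_mul {n : ℕ} (a b : Composition n) (g h : seaweedGroup a b) (x : seaweed a b) :
    conjMap a b (g * h) x = conjMap a b g (conjMap a b h x) := by
  apply Subtype.ext
  simp [conjMap, mul_assoc]

theorem conjMap_one {n : ℕ} (a b : Composition n) (x : seaweed a b) :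
    conjMap a b 1 x = x := by
  apply Subtype.ext
  simp [conjMap]

/-- The adjoint representation `Ad : Q → GL(q)`, `Ad(g) x = g x g⁻¹`. Its kernel is the
centre `Z` of `Q`. -/
def Ad {n : ℕ} (a b : Composition n) :
    seaweedGroup a b →* (seaweed a b ≃ₗ[ℂ] seaweed a b) where
  toFun g := LinearEquiv.ofLinearMap (conjMap a b g) (conjMap a b g⁻¹)
    (by
      ext1 x
      rw [LinearMap.comp_apply, ← conjMap_mul, mul_inv_cancel, conjMap_one]
      rfl)
    (by
      ext1 x
      rw [LinearMap.comp_apply, ← conjMap_mul, inv_mul_cancel, conjMap_one]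
      rfl)
  map_one' := by
    ext1 x
    exact conjMap_one a b x
  map_mul' g h := by
    ext1 x
    exact conjMap_mul a b g h x

/-- The stabiliser `Q_γ` of `γ ∈ q*` for the coadjoint action `(g γ)(x) = γ (Ad(g⁻¹) x)`. -/
def coadjointStabiliser {n : ℕ} (a b : Composition n) (γ : Module.Dual ℂ (seaweed a b)) :
    Subgroup (seaweedGroup a b) where
  carrier := {g | ∀ x, γ (Ad a b g⁻¹ x) = γ x}
  mul_mem' := by
    intro g h hg hh x
    rw [_root_.mul_inv_rev, map_mul, LinearEquiv.mul_apply, hh, hg]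
  one_mem' := by
    intro x
    rw [inv_one, map_one]
    rfl
  inv_mem' := by
    intro g hg x
    rw [← hg (Ad a b g⁻¹⁻¹ x), ← LinearEquiv.mul_apply, ← map_mul, mul_inv_cancel, map_one]
    rfl

/-- A subgroup `G` of `GL(V)` is reductive: it has no nontrivial normal subgroup consisting of
unipotent elements. For an algebraic group `G` over a field of characteristic zero (the only
case in which the notion is used) this says that the unipotent radical of `G` is trivial: the
Zariski closure of a normal unipotent subgroup is again normal and unipotent, and it is
connected. -/
def IsReductive {V : Type*} [AddCommGroup V] [Module ℂ V] (G : Subgroup (V ≃ₗ[ℂ] V)) : Prop :=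
  ∀ N : Subgroup (V ≃ₗ[ℂ] V), N ≤ G → (∀ g ∈ G, ∀ u ∈ N, g * u * g⁻¹ ∈ N) →
    (∀ u ∈ N, IsNilpotent ((u : V →ₗ[ℂ] V) - 1)) → N = ⊥

/-- `γ ∈ q*` is of reductive type: `Q_γ / Z`, which is the image of `Q_γ` in `GL(q)`, is
reductive. -/
def IsReductiveType {n : ℕ} (a b : Composition n) (γ : Module.Dual ℂ (seaweed a b)) : Prop :=
  IsReductive ((coadjointStabiliser a b γ).map (Ad a b))

/-- `γ ∈ q*` is of nilpotent type: `γ` vanishes on its stabiliser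
`q_γ = {x ∈ q | γ([x, y]) = 0 for all y ∈ q}`. -/
def IsNilpotentType {n : ℕ} (a b : Composition n) (γ : Module.Dual ℂ (seaweed a b)) : Prop :=
  ∀ x : seaweed a b, (∀ y : seaweed a b, γ ⁅x, y⁆ = 0) → γ x = 0

/-- `q` is strongly quasi-reductive: there are linear forms of reductive type, and the centre of
`q` consists of semisimple elements. -/
def IsStronglyQuasiReductive {n : ℕ} (a b : Composition n) : Prop :=
  (∃ γ : Module.Dual ℂ (seaweed a b), IsReductiveType a b γ) ∧
    ∀ x ∈ LieAlgebra.center ℂ (seaweed a b),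
      Module.End.IsSemisimple (Matrix.toLin' (x : Matrix (Fin n) (Fin n) ℂ))

/-- `H ≤ GL_n(ℂ)` is a maximal reductive stabiliser of `q(a|b)`. -/
def IsMaximalReductiveStabiliser {n : ℕ} (a b : Composition n) (H : Subgroup (GL (Fin n) ℂ)) :
    Prop :=
  IsStronglyQuasiReductive a b ∧
    ∃ γ : Module.Dual ℂ (seaweed a b), IsReductiveType a b γ ∧ IsNilpotentType a b γ ∧
      H = (coadjointStabiliser a b γ).map (seaweedGroup a b).subtype

/-! ### The meander graph -/

/-- The reflection of every block of a composition of `n`: the first vertex of a block is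
exchanged with the last one of the same block, the second one with the last but one, and so on. -/
def blockReflection {n : ℕ} (c : Composition n) (v : Fin n) : Fin n :=
  c.embedding (c.index v) (Fin.rev (c.invEmbedding v))

/-- The meander graph `Γ(a|b)` without multiplicities of edges: distinct vertices are adjacent if
they are joined by an `a`-edge or by a `b`-edge. -/
def meanderGraph {n : ℕ} (a b : Composition n) : SimpleGraph (Fin n) where
  Adj v w := v ≠ w ∧ (blockReflection a v = w ∨ blockReflection a w = v ∨
    blockReflection b v = w ∨ blockReflection b w = v)
  symm := ⟨by
    rintro v w ⟨h, h'⟩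
    exact ⟨h.symm, by tauto⟩⟩
  loopless := ⟨fun v h => h.1 rfl⟩

open Classical in
/-- The valency of a vertex in `Γ(a|b)`, an `a`-edge and a `b`-edge with the same ends being
counted as two edges. -/
noncomputable def valency {n : ℕ} (a b : Composition n) (v : Fin n) : ℕ :=
  (if blockReflection a v ≠ v then 1 else 0) + (if blockReflection b v ≠ v then 1 else 0)

/-- The connected components of `Γ(a|b)`. -/
abbrev Component {n : ℕ} (a b : Composition n) : Type := (meanderGraph a b).ConnectedComponent

/-- A connected component is a cycle if all its vertices have valency two (two vertices joined by
a double edge form a cycle); otherwise it is a segment (which may be a single vertex). -/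
def IsCycle {n : ℕ} {a b : Composition n} (X : Component a b) : Prop :=
  ∀ v ∈ X.supp, valency a b v = 2

/-- `v` is the vertex `x_k` in the list `x_1 > x_2 > ... > x_t` of all elements of `S`. -/
def IsNth {n : ℕ} (S : Set (Fin n)) (k : ℕ) (v : Fin n) : Prop :=
  v ∈ S ∧ {w ∈ S | v ≤ w}.ncard = k

/-- `lo = x_{2i}` and `hi = x_{2i-1}` for some `i ≥ 1`, where `x_1 > x_2 > ... > x_t` are the
vertices of `X`. -/
def IsPair {n : ℕ} {a b : Composition n} (X : Component a b) (lo hi : Fin n) : Prop :=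
  ∃ i : ℕ, 1 ≤ i ∧ IsNth X.supp (2 * i) lo ∧ IsNth X.supp (2 * i - 1) hi

/-- `X` (a segment or a cycle) lies inside the cycle `Y`: `Y` is a cycle, and
`y_{2i} < x_1 < y_{2i-1}` for some `i`. -/
def LiesInside {n : ℕ} {a b : Composition n} (X Y : Component a b) : Prop :=
  IsCycle Y ∧ ∃ lo hi x : Fin n, IsPair Y lo hi ∧ IsNth X.supp 1 x ∧ lo < x ∧ x < hi

open Classical in
/-- The dimension of a cycle `X` is `2 #(cycles inside X) + #(segments inside X) + 2`; segments
have dimension one. -/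
noncomputable def dimension {n : ℕ} {a b : Composition n} (X : Component a b) : ℕ :=
  if IsCycle X then
    2 * {Y : Component a b | IsCycle Y ∧ LiesInside Y X}.ncard +
      {Y : Component a b | ¬ IsCycle Y ∧ LiesInside Y X}.ncard + 2
  else 1

/-- The maximal cycles of `Γ(a|b)`: the components (cycles or segments) that do not lie inside
any cycle. -/
abbrev MaximalCycle {n : ℕ} (a b : Composition n) : Type :=
  {X : Component a b // ∀ Y : Component a b, ¬ LiesInside X Y}

noncomputable instance {n : ℕ} (a b : Composition n) : Fintype (MaximalCycle a b) :=
  Fintype.ofFinite _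

/-- The intervals `[lo, hi]` over which the group attached to `X` is embedded: the intervals
`[x_{2i}, x_{2i-1}]` if `X` is a cycle, the one-point intervals `[x_i, x_i]` if `X` is a
segment. -/
def IsInterval {n : ℕ} {a b : Composition n} (X : Component a b) (lo hi : Fin n) : Prop :=
  (IsCycle X ∧ IsPair X lo hi) ∨ (¬ IsCycle X ∧ lo ∈ X.supp ∧ hi = lo)

/-- `ι` is the diagonal embedding of `GL_r`, `r = dimension X`, over the intervals of `X`: all
these intervals have `r` elements, the diagonal block of `ι g` in rows and columns `[lo, hi]` is
`g` for each of them, and all the other entries of `ι g` are those of the identity matrix. -/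
def IsDiagonalEmbedding {n : ℕ} {a b : Composition n} (X : Component a b)
    (ι : GL (Fin (dimension X)) ℂ →* GL (Fin n) ℂ) : Prop :=
  (∀ lo hi : Fin n, IsInterval X lo hi → (hi : ℕ) + 1 = (lo : ℕ) + dimension X) ∧
  (∀ lo hi : Fin n, IsInterval X lo hi → ∀ g : GL (Fin (dimension X)) ℂ,
    ∀ i j : Fin (dimension X), ∀ p q : Fin n, (p : ℕ) = (lo : ℕ) + i → (q : ℕ) = (lo : ℕ) + j →
      (ι g : Matrix (Fin n) (Fin n) ℂ) p q
        = (g : Matrix (Fin (dimension X)) (Fin (dimension X)) ℂ) i j) ∧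
  (∀ g : GL (Fin (dimension X)) ℂ, ∀ p q : Fin n,
    (¬ ∃ lo hi : Fin n, IsInterval X lo hi ∧ p ∈ Set.Icc lo hi ∧ q ∈ Set.Icc lo hi) →
      (ι g : Matrix (Fin n) (Fin n) ℂ) p q = (1 : Matrix (Fin n) (Fin n) ℂ) p q)

end SeaweedMRS

namespace SeaweedMRS

open Matrix

attribute [local instance 100] LieRing.ofAssociativeRing

/-! The vertices are cut into intervals: the intervals [x_{2i}, x_{2i-1}] of the maximal cycles that
are cycles, and the single vertices of the maximal components that are segments. Parity replaces
planar topology here. On a cycle X both block reflections act without fixed points, so for a vertex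
outside X the parity of the number of vertices of X above it is unchanged by the reflections
(`IsCycle.odd_countAbove_blockReflection`). Hence lying inside a cycle is a strict partial order,
every vertex belongs to the intervals of exactly one maximal cycle (`exists_isMaximal_inRegion`,
`IsMaximal.eq_of_inRegion`), and the reflections permute the intervals
(`IsInterval.blockReflection`). Composed with the reversal of each interval they become translations
of intervals (`shift`), which join the intervals of one maximal cycle into a strand.

No strand is closed (`exists_strandStep_fixed`): a closed strand of a cycle would have two disjoint
boundary curves, although its boundary is the single component X, and a closed strand of a segment
would make the segment a cycle. So a strand has an end, an interval which some block reflection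
folds onto itself. This folding shows how often each inner component meets an interval, which gives
the length of the intervals (`hi_add_one`).

The linear form is x ↦ tr(Fx), where F is the sum of the matrix units of the arcs joining different
intervals, each placed so that its transpose lies in the seaweed algebra. Suppose x lies in the
algebra and [F, x] is orthogonal to it. Induction along the strands, started at their ends, shows
that x vanishes outside the diagonal blocks (`StrandSystem.IsKernel.eq_zero`) and that blocks joined
by an arc are equal (`StrandSystem.IsKernel.σ_apply`). Conversely such matrices commute with F
(`strandMatrix_mul_blockMatrix`). Since the algebra is associative, the condition for g to stabilise
the form is the same linear condition on g, so the stabiliser is exactly the product of the groups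
GL_r (`map_stabiliser_eq_range`). The form vanishes on its Lie algebra because F has no entries in
the diagonal blocks.

For reductivity, let u lie in a normal subgroup acting unipotently. The commutators of u with
transvections of one factor GL_r lie in this subgroup too, and a trace computation forces every
block of u to be scalar (`eq_smul_one_of_isNilpotent`). Then u is diagonal, so it acts semisimply as
well as unipotently, that is, trivially. -/

/-- A finite system of parallel strands: the points are collected into classes by `κ`, the
involution `σ` reverses the order of the classes in every block of `A`, the involution `τ` does so
in every block of `B`, and the heights `ha`, `hb` decrease along the strands, so that no strand is
closed. -/
structure StrandSystem (V : Type*) where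
  κ : V → ℤ
  A : V → ℕ
  B : V → ℕ
  σ : V → V
  τ : V → V
  ha : V → ℕ
  hb : V → ℕ
  σ_σ : ∀ v, σ (σ v) = v
  τ_τ : ∀ v, τ (τ v) = v
  A_σ : ∀ v, A (σ v) = A v
  B_τ : ∀ v, B (τ v) = B v
  σ_lt : ∀ p q, A p = A q → κ p < κ q → κ (σ q) < κ (σ p)
  τ_lt : ∀ p q, B p = B q → κ p < κ q → κ (τ q) < κ (τ p)
  σ_eq : ∀ p q, κ p = κ q → κ (σ p) = κ (σ q)
  τ_eq : ∀ p q, κ p = κ q → κ (τ p) = κ (τ q)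
  A_eq : ∀ p q, κ p = κ q → A p = A q
  B_eq : ∀ p q, κ p = κ q → B p = B q
  σ_fix : ∀ p, κ (σ p) = κ p → σ p = p
  τ_fix : ∀ p, κ (τ p) = κ p → τ p = p
  ha_lt : ∀ p, κ (σ p) ≠ κ p → hb (σ p) < ha p
  hb_lt : ∀ p, κ (τ p) ≠ κ p → ha (τ p) < hb p

/-! ### The kernel of a strand system is block diagonal -/

namespace StrandSystem

variable {V : Type*}

/-- The strand system with the order of the classes reversed and the two involutions exchanged. -/
def mirror (D : StrandSystem V) : StrandSystem V where
  κ v := -D.κ v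
  A := D.B
  B := D.A
  σ := D.τ
  τ := D.σ
  ha := D.hb
  hb := D.ha
  σ_σ := D.τ_τ
  τ_τ := D.σ_σ
  A_σ := D.B_τ
  B_τ := D.A_σ
  σ_lt p q h h' := by have := D.τ_lt q p h.symm; omega
  τ_lt p q h h' := by have := D.σ_lt q p h.symm; omega
  σ_eq p q h := by have := D.τ_eq p q; omega
  τ_eq p q h := by have := D.σ_eq p q; omega
  A_eq p q h := D.B_eq p q (by omega)
  B_eq p q h := D.A_eq p q (by omega)
  σ_fix p h := D.τ_fix p (by omega)
  τ_fix p h := D.σ_fix p (by omega)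
  ha_lt p h := D.hb_lt p (by omega)
  hb_lt p h := D.ha_lt p (by omega)

/-- The matrices supported on the seaweed pattern which commute with the matrix of the strands
up to the orthogonal complement of the seaweed pattern. -/
structure IsKernel (D : StrandSystem V) (x : V → V → ℂ) : Prop where
  supp : ∀ p q, D.κ p ≠ D.κ q → (D.κ p < D.κ q → D.B p ≠ D.B q) →
    (D.κ q < D.κ p → D.A p ≠ D.A q) → x p q = 0
  eqn : ∀ p q, (D.κ p < D.κ q → D.A p = D.A q) → (D.κ q < D.κ p → D.B p = D.B q) →
    (if D.κ p < D.κ (D.σ p) then x (D.σ p) q else 0) +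
      (if D.κ (D.τ p) < D.κ p then x (D.τ p) q else 0) =
    (if D.κ (D.σ q) < D.κ q then x p (D.σ q) else 0) +
      (if D.κ q < D.κ (D.τ q) then x p (D.τ q) else 0)

theorem IsKernel.mirror {D : StrandSystem V} {x : V → V → ℂ} (h : D.IsKernel x) :
    D.mirror.IsKernel x where
  supp p q h1 h2 h3 := by
    simp only [StrandSystem.mirror, neg_lt_neg_iff, ne_eq, neg_inj] at h1 h2 h3
    exact h.supp p q h1 h3 h2
  eqn p q h1 h2 := by
    simp only [StrandSystem.mirror, neg_lt_neg_iff] at h1 h2 ⊢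
    rw [add_comm, h.eqn p q h2 h1, add_comm]

/-- The entries of `x` across an arc of `σ`, with a sign for their direction. -/
def arcValue (D : StrandSystem V) (x : V → V → ℂ) (p q : V) : ℂ :=
  (if D.κ p < D.κ (D.σ p) then x (D.σ p) q else 0) -
    (if D.κ (D.σ q) < D.κ q then x p (D.σ q) else 0)

theorem arcValue_σ (D : StrandSystem V) (x : V → V → ℂ) {p q : V} (h : D.κ p = D.κ q) :
    D.arcValue x (D.σ p) (D.σ q) = -D.arcValue x p q := by
  have h1 := D.σ_eq p q h
  simp only [arcValue, D.σ_σ, h1, h]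
  ring

/-- For two points of one class the kernel equation says that the `σ`-value and the `τ`-value there
add up to zero. Crossing the arc also changes the sign, so the value travels unchanged to the next
arc of the strand. -/
theorem IsKernel.arcValue_eq {D : StrandSystem V} {x : V → V → ℂ} (h : D.IsKernel x) {p q : V}
    (hpq : D.κ p = D.κ q) : D.arcValue x p q = D.mirror.arcValue x (D.σ p) (D.σ q) := by
  have h1 := D.σ_eq p q hpq
  have h2 := h.eqn (D.σ p) (D.σ q) (by omega) (by omega)
  have h3 := D.arcValue_σ x hpq
  simp only [arcValue, StrandSystem.mirror, neg_lt_neg_iff] at h3 ⊢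
  linear_combination h3 - h2

/-- The value is carried to the end of the strand, where the arc joins a class to itself and both
terms are absent. The induction ranges over all systems because each step passes to the mirror,
which exchanges `σ` and `τ`. -/
theorem IsKernel.arcValue_eq_zero_aux (k : ℕ) : ∀ {D : StrandSystem V} {x : V → V → ℂ},
    D.IsKernel x → ∀ {p q : V}, D.κ p = D.κ q → D.ha p = k → D.arcValue x p q = 0 := by
  induction k using Nat.strong_induction_on with
  | _ k ih =>
    intro D x h p q hpq hk
    by_cases h0 : D.κ (D.σ p) = D.κ p
    · have := D.σ_eq p q hpq
      rw [arcValue, if_neg (by omega), if_neg (by omega), sub_zero]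
    · rw [h.arcValue_eq hpq]
      refine ih (D.hb (D.σ p)) (hk ▸ D.ha_lt p h0) h.mirror ?_ rfl
      have := D.σ_eq p q hpq
      simp only [StrandSystem.mirror, this]

theorem IsKernel.arcValue_eq_zero {D : StrandSystem V} {x : V → V → ℂ} (h : D.IsKernel x) {p q : V}
    (hpq : D.κ p = D.κ q) : D.arcValue x p q = 0 :=
  IsKernel.arcValue_eq_zero_aux _ h hpq rfl

/-- The entries of `x` across the arcs of `σ` vanish. -/
theorem IsKernel.arc_eq_zero {D : StrandSystem V} {x : V → V → ℂ} (h : D.IsKernel x) {p q : V}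
    (hpq : D.κ q < D.κ p) (hσ : D.κ (D.σ p) = D.κ q) : x p q = 0 := by
  have h1 := h.arcValue_eq_zero hσ
  have h2 := D.σ_eq _ _ hσ
  rw [D.σ_σ] at h2
  rwa [arcValue, D.σ_σ, if_pos (by omega), if_neg (by omega), sub_zero] at h1

/-- The `τ`-half of the kernel equation holds by itself. Within a block of `B`, the equation is
taken at the reflected pair, where its `σ`-half is already known from further along the strand; what
remains pairs each entry with a term excluded by the order. Between different blocks both entries
lie outside the support. -/
theorem IsKernel.residue_eq_zero_aux (k : ℕ) : ∀ {D : StrandSystem V} {x : V → V → ℂ},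
    D.IsKernel x → ∀ {p q : V}, D.κ p < D.κ q → D.hb p = k →
    (if D.κ (D.τ p) < D.κ p then x (D.τ p) q else 0) =
      (if D.κ q < D.κ (D.τ q) then x p (D.τ q) else 0) := by
  induction k using Nat.strong_induction_on with
  | _ k ih =>
    intro D x h p q hpq hk
    by_cases hB : D.B p = D.B q
    · have hlt := D.τ_lt p q hB hpq
      have hrec : D.κ (D.τ p) ≠ D.κ p →
          (if D.κ (D.τ p) < D.κ (D.σ (D.τ p)) then x (D.σ (D.τ p)) (D.τ q) else 0) =
          (if D.κ (D.σ (D.τ q)) < D.κ (D.τ q) then x (D.τ p) (D.σ (D.τ q)) else 0) := by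
        intro h0
        have := ih (D.ha (D.τ p)) (hk ▸ D.hb_lt p h0) h.mirror (p := D.τ p) (q := D.τ q)
          (by simpa only [StrandSystem.mirror, neg_lt_neg_iff] using hlt) rfl
        simpa only [StrandSystem.mirror, neg_lt_neg_iff] using this
      have heq := h.eqn (D.τ p) (D.τ q) (by omega) (by simp [D.B_τ, hB])
      rw [D.τ_τ, D.τ_τ] at heq
      by_cases hp : D.κ (D.τ p) < D.κ p
      · rw [hrec (by omega), if_neg (by omega : ¬ D.κ p < D.κ (D.τ p)),
          if_pos (by omega : D.κ (D.τ q) < D.κ q)] at heq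
        rw [if_pos hp, if_neg (by omega)]
        linear_combination -heq
      · by_cases hq : D.κ q < D.κ (D.τ q)
        · rw [hrec (by omega), if_pos (by omega : D.κ p < D.κ (D.τ p)),
            if_neg (by omega : ¬ D.κ (D.τ q) < D.κ q)] at heq
          rw [if_neg hp, if_pos hq]
          linear_combination -heq
        · rw [if_neg hp, if_neg hq]
    · have h1 : D.κ (D.τ p) < D.κ p → x (D.τ p) q = 0 := fun h1 =>
        h.supp _ _ (by omega) (by simp [D.B_τ, hB]) (by omega)
      have h2 : D.κ q < D.κ (D.τ q) → x p (D.τ q) = 0 := fun h1 =>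
        h.supp _ _ (by omega) (by simp [D.B_τ, hB]) (by omega)
      split_ifs with h3 h4 h4
      · rw [h1 h3, h2 h4]
      · exact h1 h3
      · exact (h2 h4).symm
      · rfl

/-- Subtracting the `τ`-half leaves the `σ`-half, a relation inside one block of `A` only. -/
theorem IsKernel.eqn_σ {D : StrandSystem V} {x : V → V → ℂ} (h : D.IsKernel x) {p q : V}
    (hpq : D.κ p < D.κ q) (hA : D.A p = D.A q) :
    (if D.κ p < D.κ (D.σ p) then x (D.σ p) q else 0) =
      (if D.κ (D.σ q) < D.κ q then x p (D.σ q) else 0) := by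
  have h1 := IsKernel.residue_eq_zero_aux _ h hpq rfl
  have h2 := h.eqn p q (by simp [hA]) (by omega)
  linear_combination h2 - h1

/-- The entry at (p, q) is compared through `eqn_σ` with the entry at (σ p, σ q), which lies on the
other side of the diagonal and vanishes by induction in the mirror system. The one position not
reached in this way is the arc itself, covered by `arc_eq_zero`. -/
theorem IsKernel.eq_zero_aux (k : ℕ) : ∀ {D : StrandSystem V} {x : V → V → ℂ},
    D.IsKernel x → ∀ {p q : V}, D.κ q < D.κ p → D.ha p = k → x p q = 0 := by
  induction k using Nat.strong_induction_on with
  | _ k ih =>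
    intro D x h p q hpq hk
    by_cases hA : D.A p = D.A q
    · have hlt := D.σ_lt q p hA.symm hpq
      have hrec : D.κ (D.σ p) ≠ D.κ p → x (D.σ p) (D.σ q) = 0 := by
        intro h0
        refine ih (D.hb (D.σ p)) (hk ▸ D.ha_lt p h0) h.mirror ?_ rfl
        simpa only [StrandSystem.mirror, neg_lt_neg_iff] using hlt
      rcases lt_trichotomy (D.κ (D.σ p)) (D.κ q) with h1 | h1 | h1
      · have h2 := h.eqn_σ h1 (by rw [D.A_σ, hA])
        rw [D.σ_σ, if_pos (by omega), hrec (by omega), ite_self] at h2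
        exact h2
      · exact h.arc_eq_zero hpq h1
      · have h2 := D.σ_lt q (D.σ p) (by rw [D.A_σ, hA]) h1
        rw [D.σ_σ] at h2
        have h3 := h.eqn_σ h2 (by rw [D.A_σ, hA])
        rw [D.σ_σ, if_pos (by omega : D.κ q < _)] at h3
        rw [← h3]
        split_ifs with h4
        · exact hrec (by omega)
        · rfl
    · exact h.supp _ _ (by omega) (by omega) (by simp [hA])

/-- The elements of the kernel are block diagonal. -/
theorem IsKernel.eq_zero {D : StrandSystem V} {x : V → V → ℂ} (h : D.IsKernel x) {p q : V}
    (hpq : D.κ p ≠ D.κ q) : x p q = 0 := by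
  rcases lt_or_gt_of_ne hpq with h1 | h1
  · exact IsKernel.eq_zero_aux _ h.mirror (by simpa only [StrandSystem.mirror, neg_lt_neg_iff]) rfl
  · exact IsKernel.eq_zero_aux _ h h1 rfl

/-- For an ascending arc this is `eqn_σ` at (p, σ q); a descending arc is read backwards, and an arc
from a class to itself fixes every point. -/
theorem IsKernel.σ_apply {D : StrandSystem V} {x : V → V → ℂ} (h : D.IsKernel x) {p q : V}
    (hpq : D.κ p = D.κ q) : x (D.σ p) (D.σ q) = x p q := by
  have key : ∀ p q, D.κ p = D.κ q → D.κ p < D.κ (D.σ p) → x (D.σ p) (D.σ q) = x p q := by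
    intro p q hpq hlt
    have hσ := D.σ_eq p q hpq
    have h1 := h.eqn_σ (p := p) (q := D.σ q) (by omega) (by rw [D.A_σ, D.A_eq p q hpq])
    rwa [D.σ_σ, if_pos hlt, if_pos (by omega)] at h1
  have hσ := D.σ_eq p q hpq
  rcases lt_trichotomy (D.κ p) (D.κ (D.σ p)) with h1 | h1 | h1
  · exact key p q hpq h1
  · rw [D.σ_fix p h1.symm, D.σ_fix q (by omega)]
  · have := key (D.σ p) (D.σ q) hσ (by rwa [D.σ_σ])
    rw [D.σ_σ, D.σ_σ] at this
    exact this.symm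

theorem IsKernel.τ_apply {D : StrandSystem V} {x : V → V → ℂ} (h : D.IsKernel x) {p q : V}
    (hpq : D.κ p = D.κ q) : x (D.τ p) (D.τ q) = x p q :=
  h.mirror.σ_apply (by simp only [StrandSystem.mirror, hpq])

end StrandSystem

/-! ### Block reflections -/

section Reflection

variable {n : ℕ} (c : Composition n)

theorem index_mono : Monotone c.index := by
  intro v w h
  by_contra! h1
  have h2 := c.lt_sizeUpTo_index_succ w
  have h3 := c.sizeUpTo_index_le v
  have h4 : c.sizeUpTo (c.index w).succ ≤ c.sizeUpTo (c.index v) := c.monotone_sizeUpTo h1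
  have h5 : (v : ℕ) ≤ w := h
  omega

theorem index_blockReflection (v : Fin n) : c.index (blockReflection c v) = c.index v :=
  c.index_embedding _ _

theorem coe_blockReflection (v : Fin n) : (blockReflection c v : ℕ) + v + 1 =
    2 * c.sizeUpTo (c.index v) + c.blocksFun (c.index v) := by
  have h1 := c.sizeUpTo_index_le v
  have h2 := (c.invEmbedding v).2
  simp only [blockReflection, c.coe_embedding, Fin.val_rev]
  rw [c.coe_invEmbedding] at *
  omega

/-- A reflection is determined by a sum constant on the block; in this form the later identities
between reflections are linear arithmetic. -/
theorem blockReflection_add {v w : Fin n} (h : c.index v = c.index w) :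
    (blockReflection c v : ℕ) + v = blockReflection c w + w := by
  have h1 := coe_blockReflection c v
  have h2 := coe_blockReflection c w
  rw [h] at h1
  omega

theorem blockReflection_blockReflection (v : Fin n) :
    blockReflection c (blockReflection c v) = v := by
  have := blockReflection_add c (index_blockReflection c v)
  ext
  omega

theorem blockReflection_lt {v w : Fin n} (h : c.index v = c.index w) :
    blockReflection c v < blockReflection c w ↔ w < v := by
  have := blockReflection_add c h
  simp only [Fin.lt_def]
  omega

end Reflection

theorem even_card_of_involution {α : Type*} (s : Finset α) (f : α → α) (hs : ∀ v ∈ s, f v ∈ s)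
    (hf : ∀ v ∈ s, f (f v) = v) (hne : ∀ v ∈ s, f v ≠ v) : Even s.card := by
  have h : ∑ _v ∈ s, (1 : ZMod 2) = 0 :=
    Finset.sum_involution (fun v _ => f v) (fun _ _ => by decide) (fun v hv _ => hne v hv)
      hs hf
  rw [Finset.sum_const, nsmul_eq_mul, mul_one] at h
  exact (ZMod.natCast_eq_zero_iff_even).1 h

/-! ### Components of the meander graph and parity -/

section Component

variable {n : ℕ} {a b : Composition n} {c : Composition n}

theorem blockReflection_mem (hc : c = a ∨ c = b) (X : Component a b) {v : Fin n} :
    blockReflection c v ∈ X.supp ↔ v ∈ X.supp := by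
  by_cases h : blockReflection c v = v
  · rw [h]
  · refine X.mem_supp_congr_adj ⟨h, ?_⟩
    rcases hc with rfl | rfl <;> tauto

theorem IsCycle.blockReflection_ne (hc : c = a ∨ c = b) {X : Component a b} (hX : IsCycle X)
    {v : Fin n} (hv : v ∈ X.supp) : blockReflection c v ≠ v := by
  intro h
  have h1 := hX v hv
  unfold valency at h1
  rcases hc with rfl | rfl
  · rw [if_neg (by simpa using h)] at h1
    split_ifs at h1 <;> omega
  · rw [if_neg (not_not.2 h)] at h1
    split_ifs at h1 <;> omega

/-- Sets of vertices closed under both reflections which meet a component contain it. -/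
theorem component_induction {X : Component a b} {P : Fin n → Prop}
    (hP : ∀ c, c = a ∨ c = b → ∀ v ∈ X.supp, P v → P (blockReflection c v)) {v w : Fin n}
    (hv : v ∈ X.supp) (hw : w ∈ X.supp) (h : P v) : P w := by
  have hr : (meanderGraph a b).Reachable v w := by
    rw [← SimpleGraph.ConnectedComponent.eq]
    exact hv.trans hw.symm
  obtain ⟨p⟩ := hr
  induction p with
  | nil => exact h
  | @cons u x y hux p ih =>
    have hx : x ∈ X.supp := (X.mem_supp_congr_adj hux).1 hv
    refine ih hx hw ?_
    rcases hux.2 with h1 | h1 | h1 | h1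
    · exact h1 ▸ hP a (Or.inl rfl) u hv h
    · have h2 : x = blockReflection a u := by rw [← h1, blockReflection_blockReflection]
      exact h2 ▸ hP a (Or.inl rfl) u hv h
    · exact h1 ▸ hP b (Or.inr rfl) u hv h
    · have h2 : x = blockReflection b u := by rw [← h1, blockReflection_blockReflection]
      exact h2 ▸ hP b (Or.inr rfl) u hv h

open Classical in
/-- The number of vertices of `X` above `v`. -/
noncomputable def countAbove (X : Component a b) (v : Fin n) : ℕ :=
  (Finset.univ.filter fun w => w ∈ X.supp ∧ v < w).card

theorem countAbove_anti (X : Component a b) {v w : Fin n} (h : v ≤ w) :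
    countAbove X w ≤ countAbove X v := by
  classical
  exact Finset.card_le_card fun u hu => by
    simp only [Finset.mem_filter, Finset.mem_univ, true_and] at hu ⊢
    exact ⟨hu.1, h.trans_lt hu.2⟩

theorem countAbove_lt {X : Component a b} {v w : Fin n} (h : v < w) (hw : w ∈ X.supp) :
    countAbove X w < countAbove X v := by
  classical
  exact Finset.card_lt_card ⟨fun u hu => by
    simp only [Finset.mem_filter, Finset.mem_univ, true_and] at hu ⊢
    exact ⟨hu.1, h.trans hu.2⟩, fun hs => by
    have := hs (Finset.mem_filter.2 ⟨Finset.mem_univ w, hw, h⟩)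
    simp at this⟩

theorem countAbove_inj {X : Component a b} {v w : Fin n} (hv : v ∈ X.supp) (hw : w ∈ X.supp)
    (h : countAbove X v = countAbove X w) : v = w := by
  rcases lt_trichotomy v w with h1 | h1 | h1
  · exact absurd h (countAbove_lt h1 hw).ne'
  · exact h1
  · exact absurd h (countAbove_lt h1 hv).ne

theorem countAbove_eq {X : Component a b} {v w : Fin n} (h : v ≤ w)
    (h1 : ∀ u ∈ X.supp, v < u → w < u) : countAbove X v = countAbove X w := by
  classical
  refine congrArg Finset.card (Finset.filter_congr fun u _ => ?_)
  exact ⟨fun hu => ⟨hu.1, h1 u hu.1 hu.2⟩, fun hu => ⟨hu.1, h.trans_lt hu.2⟩⟩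

/-- The rank counts the vertex itself, `countAbove` does not; hence the shift by one. The upper ends
of pairs, of odd rank, thus have an even number of vertices above them. -/
theorem isNth_iff {X : Component a b} {k : ℕ} {v : Fin n} :
    IsNth X.supp k v ↔ v ∈ X.supp ∧ countAbove X v + 1 = k := by
  classical
  refine and_congr_right fun hv => ?_
  have : {w ∈ X.supp | v ≤ w} =
      ((insert v (Finset.univ.filter fun w => w ∈ X.supp ∧ v < w) : Finset (Fin n)) :
        Set (Fin n)) := by
    ext w
    simp only [Set.mem_ofPred_eq, Finset.coe_insert, Finset.coe_filter, Finset.mem_univ, true_and,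
      Set.mem_insert_iff, le_iff_eq_or_lt]
    constructor
    · rintro ⟨h1, rfl | h2⟩
      · exact Or.inl rfl
      · exact Or.inr ⟨h1, h2⟩
    · rintro (rfl | ⟨h1, h2⟩)
      · exact ⟨hv, Or.inl rfl⟩
      · exact ⟨h1, Or.inr h2⟩
  rw [this, Set.ncard_coe_finset, Finset.card_insert_of_notMem (by simp), countAbove]

theorem isPair_iff {X : Component a b} {lo hi : Fin n} :
    IsPair X lo hi ↔ lo ∈ X.supp ∧ hi ∈ X.supp ∧ Even (countAbove X hi) ∧
      countAbove X lo = countAbove X hi + 1 := by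
  simp only [IsPair, isNth_iff]
  constructor
  · rintro ⟨i, hi, ⟨h1, h2⟩, h3, h4⟩
    exact ⟨h1, h3, ⟨i - 1, by omega⟩, by omega⟩
  · rintro ⟨h1, h2, ⟨k, hk⟩, h3⟩
    exact ⟨k + 1, by omega, ⟨h1, by omega⟩, h2, by omega⟩

theorem IsPair.lt {X : Component a b} {lo hi : Fin n} (h : IsPair X lo hi) : lo < hi := by
  obtain ⟨-, -, -, h⟩ := isPair_iff.1 h
  by_contra! h1
  have := countAbove_anti X h1
  omega

theorem IsPair.eq_of_mem {X : Component a b} {lo hi v : Fin n} (h : IsPair X lo hi)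
    (hv : v ∈ X.supp) (h1 : lo ≤ v) (h2 : v ≤ hi) : v = lo ∨ v = hi := by
  obtain ⟨h3, h4, -, h5⟩ := isPair_iff.1 h
  by_contra! h6
  have := countAbove_lt (lt_of_le_of_ne h1 h6.1.symm) hv
  have := countAbove_lt (lt_of_le_of_ne h2 h6.2) h4
  omega

theorem isPair_of_consecutive {X : Component a b} {lo hi : Fin n} (hlo : lo ∈ X.supp)
    (hhi : hi ∈ X.supp) (hlt : lo < hi) (he : Even (countAbove X hi))
    (h : ∀ v ∈ X.supp, lo < v → hi ≤ v) : IsPair X lo hi := by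
  classical
  refine isPair_iff.2 ⟨hlo, hhi, he, ?_⟩
  rw [countAbove, countAbove, ← Finset.card_insert_of_notMem (a := hi) (by simp)]
  congr 1
  ext w
  simp only [Finset.mem_filter, Finset.mem_univ, true_and, Finset.mem_insert]
  constructor
  · rintro ⟨h1, h2⟩
    rcases (h w h1 h2).eq_or_lt with h3 | h3
    · exact Or.inl h3.symm
    · exact Or.inr ⟨h1, h3⟩
  · rintro (rfl | ⟨h1, h2⟩)
    · exact ⟨hhi, hlt⟩
    · exact ⟨h1, hlt.trans h2⟩

theorem IsCycle.even_card_filter {X : Component a b} (hX : IsCycle X) (hc : c = a ∨ c = b)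
    (P : Fin c.length → Prop) [DecidablePred fun w => w ∈ X.supp ∧ P (c.index w)] :
    Even (Finset.univ.filter fun w => w ∈ X.supp ∧ P (c.index w)).card := by
  refine even_card_of_involution _ (blockReflection c) ?_ ?_ ?_
  · intro v hv
    simpa only [Finset.mem_filter, Finset.mem_univ, true_and, blockReflection_mem hc,
      index_blockReflection] using hv
  · intro v _
    exact blockReflection_blockReflection c v
  · intro v hv
    exact hX.blockReflection_ne hc (by simpa using (Finset.mem_filter.1 hv).2.1)

theorem IsCycle.even_ncard {X : Component a b} (hX : IsCycle X) : Even X.supp.ncard := by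
  classical
  have h := hX.even_card_filter (c := a) (Or.inl rfl) (fun _ => True)
  rwa [← Set.ncard_coe_finset, Finset.coe_filter, show {x | x ∈ Finset.univ ∧ x ∈ X.supp ∧ True} =
    X.supp by ext; simp] at h

open Classical in
/-- A cycle has an even number of vertices above `v` and above the reflection of `v`, taken
together and with `v` itself. -/
theorem IsCycle.even_countAbove {X : Component a b} (hX : IsCycle X) (hc : c = a ∨ c = b)
    (v : Fin n) :
    Even (countAbove X v + countAbove X (blockReflection c v) + if v ∈ X.supp then 1 else 0) := by
  -- The vertices above u are those in later blocks and those above u in its own block. The former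
  -- are even in number, as the reflection pairs them off, and so is the whole of X in the block of
  -- v; the reflection turns what lies above the image of v into what lies below v.
  have key : ∀ u : Fin n, c.index u = c.index v → countAbove X u =
      (Finset.univ.filter fun w => w ∈ X.supp ∧ c.index v < c.index w).card +
      (Finset.univ.filter fun w => w ∈ X.supp ∧ c.index w = c.index v ∧ u < w).card := by
    intro u hu
    rw [← Finset.card_union_of_disjoint, countAbove]
    · congr 1
      ext w
      simp only [Finset.mem_filter, Finset.mem_univ, true_and, Finset.mem_union]
      constructor
      · rintro ⟨h1, h2⟩
        rcases (index_mono c h2.le).lt_or_eq with h3 | h3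
        · exact Or.inl ⟨h1, hu ▸ h3⟩
        · exact Or.inr ⟨h1, hu ▸ h3.symm, h2⟩
      · rintro (⟨h1, h2⟩ | ⟨h1, -, h2⟩)
        · exact ⟨h1, lt_of_not_ge fun h3 => (index_mono c h3).not_gt (hu ▸ h2)⟩
        · exact ⟨h1, h2⟩
    · rw [Finset.disjoint_left]
      intro w hw hw'
      simp only [Finset.mem_filter, Finset.mem_univ, true_and] at hw hw'
      exact hw.2.ne' hw'.2.1
  have h1 : Even (Finset.univ.filter fun w => w ∈ X.supp ∧ c.index v < c.index w).card := by
    convert hX.even_card_filter hc fun i => c.index v < i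
  have h2 : Even (Finset.univ.filter fun w => w ∈ X.supp ∧ c.index w = c.index v).card := by
    convert hX.even_card_filter hc fun i => i = c.index v
  have h3 : (Finset.univ.filter fun w => w ∈ X.supp ∧ c.index w = c.index v ∧
        blockReflection c v < w).card =
      (Finset.univ.filter fun w => w ∈ X.supp ∧ c.index w = c.index v ∧ w < v).card := by
    refine Finset.card_bij' (fun w _ => blockReflection c w) (fun w _ => blockReflection c w)
      ?_ ?_ ?_ ?_
    · intro w hw
      simp only [Finset.mem_filter, Finset.mem_univ, true_and, blockReflection_mem hc,
        index_blockReflection] at hw ⊢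
      refine ⟨hw.1, hw.2.1, ?_⟩
      rw [← blockReflection_lt c (by rw [index_blockReflection, hw.2.1]),
        blockReflection_blockReflection]
      exact hw.2.2
    · intro w hw
      simp only [Finset.mem_filter, Finset.mem_univ, true_and, blockReflection_mem hc,
        index_blockReflection] at hw ⊢
      exact ⟨hw.1, hw.2.1, (blockReflection_lt c hw.2.1.symm).2 hw.2.2⟩
    · intro w _
      exact blockReflection_blockReflection c w
    · intro w _
      exact blockReflection_blockReflection c w
  have h4 : (Finset.univ.filter fun w => w ∈ X.supp ∧ c.index w = c.index v).card =
      (Finset.univ.filter fun w => w ∈ X.supp ∧ c.index w = c.index v ∧ v < w).card +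
      (Finset.univ.filter fun w => w ∈ X.supp ∧ c.index w = c.index v ∧ w < v).card +
      if v ∈ X.supp then 1 else 0 := by
    have h5 : (if v ∈ X.supp then 1 else 0) =
        (Finset.univ.filter fun w => w ∈ X.supp ∧ w = v).card := by
      split_ifs with h
      · symm
        rw [Finset.card_eq_one]
        exact ⟨v, by
          ext w
          simp only [Finset.mem_filter, Finset.mem_univ, true_and, Finset.mem_singleton,
            and_iff_right_iff_imp]
          rintro rfl
          exact h⟩
      · symm
        rw [Finset.card_eq_zero, Finset.filter_eq_empty_iff]
        rintro w - ⟨hw, rfl⟩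
        exact h hw
    rw [h5, ← Finset.card_union_of_disjoint, ← Finset.card_union_of_disjoint]
    · congr 1
      ext w
      simp only [Finset.mem_filter, Finset.mem_univ, true_and, Finset.mem_union]
      constructor
      · rintro ⟨h1, h2⟩
        rcases lt_trichotomy v w with h3 | h3 | h3 <;> simp [*]
      · rintro ((h1 | h1) | h1)
        · exact ⟨h1.1, h1.2.1⟩
        · exact ⟨h1.1, h1.2.1⟩
        · exact ⟨h1.1, by rw [h1.2]⟩
    · rw [Finset.disjoint_left]
      intro w hw hw'
      simp only [Finset.mem_filter, Finset.mem_univ, true_and, Finset.mem_union] at hw hw'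
      rcases hw with hw | hw
      · exact hw.2.2.ne' hw'.2
      · exact hw.2.2.ne hw'.2
    · rw [Finset.disjoint_left]
      intro w hw hw'
      simp only [Finset.mem_filter, Finset.mem_univ, true_and] at hw hw'
      exact hw.2.2.not_gt hw'.2.2
  rw [key v rfl, key (blockReflection c v) (index_blockReflection c v), h3]
  rw [h4] at h2
  obtain ⟨i, hi⟩ := h1
  obtain ⟨j, hj⟩ := h2
  exact ⟨2 * i + j, by omega⟩

/-- This is the combinatorial Jordan curve theorem: odd parity means inside, and an arc between
points off the cycle does not cross it. -/
theorem IsCycle.odd_countAbove_blockReflection {X : Component a b} (hX : IsCycle X)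
    (hc : c = a ∨ c = b) {v : Fin n} (hv : v ∉ X.supp) :
    Odd (countAbove X (blockReflection c v)) ↔ Odd (countAbove X v) := by
  have h := hX.even_countAbove hc v
  rw [if_neg hv, add_zero, Nat.even_add] at h
  rw [← Nat.not_even_iff_odd, ← Nat.not_even_iff_odd, h]

theorem countAbove_lt_ncard {X : Component a b} {v : Fin n} (hv : v ∈ X.supp) :
    countAbove X v < X.supp.ncard := by
  classical
  rw [countAbove, ← Set.ncard_coe_finset]
  refine Set.ncard_lt_ncard ⟨fun w hw => ?_, fun h => ?_⟩ (Set.toFinite _)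
  · simpa using (Finset.mem_filter.1 (Finset.mem_coe.1 hw)).2.1
  · have := h hv
    simp at this

theorem exists_countAbove_eq (X : Component a b) {k : ℕ} (hk : k < X.supp.ncard) :
    ∃ v ∈ X.supp, countAbove X v = k := by
  classical
  have h1 : ((X.supp.toFinset).image (countAbove X)) = Finset.range X.supp.ncard := by
    refine Finset.eq_of_subset_of_card_le ?_ ?_
    · intro m hm
      obtain ⟨v, hv, rfl⟩ := Finset.mem_image.1 hm
      exact Finset.mem_range.2 (countAbove_lt_ncard (by simpa using hv))
    · rw [Finset.card_range, Finset.card_image_of_injOn, Set.ncard_eq_toFinset_card']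
      intro v hv w hw h
      exact countAbove_inj (by simpa using hv) (by simpa using hw) h
  have h2 := Finset.mem_range.2 hk
  rw [← h1] at h2
  obtain ⟨v, hv, h⟩ := Finset.mem_image.1 h2
  exact ⟨v, by simpa using hv, h⟩

end Component

/-! ### Intervals of a component, nesting of components, maximal cycles -/

section Interval

variable {n : ℕ} {a b : Composition n} {c : Composition n}

/-- The points of the intervals of `X`. -/
def InRegion (X : Component a b) (v : Fin n) : Prop :=
  v ∈ X.supp ∨ (IsCycle X ∧ Odd (countAbove X v))

theorem IsCycle.exists_isPair {X : Component a b} (hX : IsCycle X) {v : Fin n}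
    (hv : v ∈ X.supp ∨ Odd (countAbove X v)) : ∃ lo hi, IsPair X lo hi ∧ lo ≤ v ∧ v ≤ hi := by
  obtain ⟨m, hm⟩ := hX.even_ncard
  have hle : ∀ k, (v ∈ X.supp → k < X.supp.ncard) → (v ∉ X.supp → k ≤ X.supp.ncard) →
      countAbove X v = k → 2 * (k / 2) + 1 < X.supp.ncard ∧ (v ∉ X.supp → k % 2 = 1) := by
    intro k h1 h2 h3
    by_cases h : v ∈ X.supp
    · have := h1 h
      exact ⟨by omega, fun h' => absurd h h'⟩
    · obtain ⟨j, hj⟩ := hv.resolve_left h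
      have := h2 h
      exact ⟨by omega, fun _ => by omega⟩
  have hcard : countAbove X v ≤ X.supp.ncard := by
    classical
    rw [countAbove, ← Set.ncard_coe_finset]
    refine Set.ncard_le_ncard (fun w hw => ?_) (Set.toFinite _)
    simpa using (Finset.mem_filter.1 (Finset.mem_coe.1 hw)).2.1
  obtain ⟨h1, h2⟩ := hle _ (fun h => countAbove_lt_ncard h) (fun _ => hcard) rfl
  -- With k vertices above v, the pair consists of the vertices with 2⌊k/2⌋ and 2⌊k/2⌋ + 1 vertices
  -- above. Both exist because X has an even number of vertices and k is odd when v is off X.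
  obtain ⟨hi, hhi, hk⟩ := exists_countAbove_eq X (k := 2 * (countAbove X v / 2)) (by omega)
  obtain ⟨lo, hlo, hl⟩ := exists_countAbove_eq X h1
  refine ⟨lo, hi, isPair_iff.2 ⟨hlo, hhi, ⟨countAbove X v / 2, by omega⟩, by omega⟩, ?_, ?_⟩
  · by_contra! h
    have := countAbove_lt h hlo
    omega
  · by_contra! h
    by_cases hv' : v ∈ X.supp
    · have := countAbove_lt h hv'
      omega
    · have := countAbove_anti X h.le
      have := h2 hv'
      omega

theorem InRegion.exists_isInterval {X : Component a b} {v : Fin n} (hv : InRegion X v) :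
    ∃ lo hi, IsInterval X lo hi ∧ lo ≤ v ∧ v ≤ hi := by
  by_cases hX : IsCycle X
  · obtain ⟨lo, hi, h, h1, h2⟩ := hX.exists_isPair (hv.imp_right And.right)
    exact ⟨lo, hi, Or.inl ⟨hX, h⟩, h1, h2⟩
  · exact ⟨v, v, Or.inr ⟨hX, hv.resolve_right fun h => hX h.1, rfl⟩, le_rfl, le_rfl⟩

theorem IsPair.odd_countAbove {X : Component a b} {lo hi v : Fin n} (h : IsPair X lo hi)
    (h1 : lo ≤ v) (h2 : v < hi) : Odd (countAbove X v) := by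
  obtain ⟨-, h4, ⟨k, hk⟩, h5⟩ := isPair_iff.1 h
  have := countAbove_lt h2 h4
  have := countAbove_anti X h1
  exact ⟨k, by omega⟩

theorem IsInterval.inRegion {X : Component a b} {lo hi v : Fin n} (h : IsInterval X lo hi)
    (h1 : lo ≤ v) (h2 : v ≤ hi) : InRegion X v := by
  rcases h with ⟨hX, h⟩ | ⟨-, h, rfl⟩
  · rcases h2.eq_or_lt with rfl | h2
    · exact Or.inl (isPair_iff.1 h).2.1
    · exact Or.inr ⟨hX, h.odd_countAbove h1 h2⟩
  · exact Or.inl (le_antisymm h2 h1 ▸ h)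

theorem IsInterval.le {X : Component a b} {lo hi : Fin n} (h : IsInterval X lo hi) : lo ≤ hi := by
  rcases h with ⟨-, h⟩ | ⟨-, -, rfl⟩
  · exact h.lt.le
  · exact le_rfl

theorem IsInterval.lo_mem {X : Component a b} {lo hi : Fin n} (h : IsInterval X lo hi) :
    lo ∈ X.supp := by
  rcases h with ⟨-, h⟩ | ⟨-, h, rfl⟩
  · exact (isPair_iff.1 h).1
  · exact h

theorem IsInterval.hi_mem {X : Component a b} {lo hi : Fin n} (h : IsInterval X lo hi) :
    hi ∈ X.supp := by
  rcases h with ⟨-, h⟩ | ⟨-, h, rfl⟩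
  · exact (isPair_iff.1 h).2.1
  · exact h

theorem IsInterval.eq_of_mem {X : Component a b} {lo hi v : Fin n} (h : IsInterval X lo hi)
    (hv : v ∈ X.supp) (h1 : lo ≤ v) (h2 : v ≤ hi) : v = lo ∨ v = hi := by
  rcases h with ⟨-, h⟩ | ⟨-, -, rfl⟩
  · exact h.eq_of_mem hv h1 h2
  · exact Or.inl (le_antisymm h2 h1)

theorem IsInterval.unique {X : Component a b} {lo hi lo' hi' v : Fin n} (h : IsInterval X lo hi)
    (h' : IsInterval X lo' hi') (h1 : lo ≤ v) (h2 : v ≤ hi) (h1' : lo' ≤ v) (h2' : v ≤ hi') :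
    lo = lo' ∧ hi = hi' := by
  rcases h with ⟨hX, h⟩ | ⟨hX, -, rfl⟩
  · obtain ⟨h3, h4, ⟨k, hk⟩, h5⟩ := isPair_iff.1 h
    have h6 : IsPair X lo' hi' := by
      rcases h' with h' | h'
      · exact h'.2
      · exact absurd hX h'.1
    obtain ⟨h3', h4', ⟨k', hk'⟩, h5'⟩ := isPair_iff.1 h6
    have := countAbove_anti X h1
    have := countAbove_anti X h2
    have := countAbove_anti X h1'
    have := countAbove_anti X h2'
    exact ⟨countAbove_inj h3 h3' (by omega), countAbove_inj h4 h4' (by omega)⟩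
  · rcases h' with h' | ⟨-, -, rfl⟩
    · exact absurd h'.1 hX
    · have := le_antisymm h1 h2
      have := le_antisymm h1' h2'
      simp_all

/-- If a block boundary separated the two ends, the vertices of X from the upper end on would fill
whole blocks and be even in number; but there is an even number strictly above that end. -/
theorem IsPair.index_eq {X : Component a b} (hX : IsCycle X) (hc : c = a ∨ c = b) {lo hi : Fin n}
    (h : IsPair X lo hi) : c.index lo = c.index hi := by
  classical
  obtain ⟨h3, h4, h5, h6⟩ := isPair_iff.1 h
  by_contra h1
  have h2 : c.index lo < c.index hi := lt_of_le_of_ne (index_mono c h.lt.le) h1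
  have h7 := hX.even_card_filter hc fun i => c.index hi ≤ i
  have h8 : (Finset.univ.filter fun w => w ∈ X.supp ∧ c.index hi ≤ c.index w) =
      insert hi (Finset.univ.filter fun w => w ∈ X.supp ∧ hi < w) := by
    ext w
    simp only [Finset.mem_filter, Finset.mem_univ, true_and, Finset.mem_insert]
    constructor
    · rintro ⟨h9, h10⟩
      have h11 : lo < w := lt_of_not_ge fun h12 => (index_mono c h12).not_gt (h2.trans_le h10)
      rcases le_or_gt w hi with h12 | h12
      · rcases h.eq_of_mem h9 h11.le h12 with h13 | h13
        · exact absurd h13 h11.ne'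
        · exact Or.inl h13
      · exact Or.inr ⟨h9, h12⟩
    · rintro (rfl | ⟨h9, h10⟩)
      · exact ⟨h4, le_rfl⟩
      · exact ⟨h9, index_mono c h10.le⟩
  have h9 : Even (countAbove X hi + 1) := by
    rw [countAbove, ← Finset.card_insert_of_notMem (a := hi) (by simp), ← h8]
    convert h7
  exact Nat.not_even_iff_odd.2 h5.add_one h9

theorem IsInterval.index_eq {X : Component a b} (hc : c = a ∨ c = b) {lo hi : Fin n}
    (h : IsInterval X lo hi) : c.index lo = c.index hi := by
  rcases h with ⟨hX, h⟩ | ⟨-, -, rfl⟩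
  · exact h.index_eq hX hc
  · rfl

theorem IsInterval.blockReflection {X : Component a b} (hc : c = a ∨ c = b) {lo hi : Fin n}
    (h : IsInterval X lo hi) : IsInterval X (blockReflection c hi) (blockReflection c lo) := by
  rcases h with ⟨hX, h⟩ | ⟨hX, h, rfl⟩
  · have hidx := h.index_eq hX hc
    obtain ⟨h3, h4, h5, h6⟩ := isPair_iff.1 h
    refine Or.inl ⟨hX, isPair_of_consecutive ((blockReflection_mem hc X).2 h4)
      ((blockReflection_mem hc X).2 h3) ((blockReflection_lt c hidx.symm).2 h.lt) ?_ ?_⟩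
    -- The number above `lo` is odd and `lo` itself counts once, so the number above its reflection,
    -- the new upper end, is even.
    · have h7 := hX.even_countAbove hc lo
      rw [if_pos h3, h6] at h7
      simp only [Nat.even_add, Nat.even_add_one] at h7
      tauto
    · intro w hw h7
      by_contra! h8
      have hw' : c.index w = c.index lo := by
        have h9 := index_mono c h7.le
        have h10 := index_mono c h8.le
        rw [index_blockReflection] at h9 h10
        exact le_antisymm h10 (hidx.trans_le h9)
      have h9 := (blockReflection_lt c (v := w) (w := SeaweedMRS.blockReflection c hi)
        (by rw [index_blockReflection, hw', hidx])).2 h7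
      have h10 := (blockReflection_lt c (w := w) (v := SeaweedMRS.blockReflection c lo)
        (by rw [index_blockReflection, hw'])).2 h8
      rw [blockReflection_blockReflection] at h9 h10
      rcases h.eq_of_mem ((blockReflection_mem hc X).2 hw) h10.le h9.le with h11 | h11
      · exact h10.ne' h11
      · exact h9.ne h11
  · exact Or.inr ⟨hX, (blockReflection_mem hc X).2 h, rfl⟩

/-- `Y` lies inside the cycle `X`. -/
def Surrounds (X Y : Component a b) : Prop :=
  IsCycle X ∧ Y ≠ X ∧ ∃ v ∈ Y.supp, Odd (countAbove X v)

theorem not_mem_supp {X Y : Component a b} (h : Y ≠ X) {v : Fin n} (hv : v ∈ Y.supp) :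
    v ∉ X.supp := fun h' => h (hv.symm.trans h')

/-- The parity is constant along Y because no vertex of Y lies on X. -/
theorem Surrounds.odd {X Y : Component a b} (h : Surrounds X Y) {v : Fin n} (hv : v ∈ Y.supp) :
    Odd (countAbove X v) := by
  obtain ⟨hX, hne, w, hw, ho⟩ := h
  refine component_induction (P := fun v => Odd (countAbove X v)) ?_ hw hv ho
  intro c hc u hu h
  exact (hX.odd_countAbove_blockReflection hc (not_mem_supp hne hu)).2 h

theorem InRegion.surrounds {X Y : Component a b} {v : Fin n} (h : InRegion X v) (hv : v ∈ Y.supp)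
    (hne : Y ≠ X) : Surrounds X Y := by
  obtain ⟨h1, h2⟩ := h.resolve_left (not_mem_supp hne hv)
  exact ⟨h1, hne, v, hv, h2⟩

theorem Surrounds.exists_gt {X Y : Component a b} (h : Surrounds X Y) :
    ∃ w ∈ X.supp, ∀ v ∈ Y.supp, v < w := by
  classical
  obtain ⟨u, hu⟩ := Y.nonempty_supp
  obtain ⟨v, hv, hmax⟩ := Set.exists_max_image Y.supp id (Set.toFinite _) ⟨u, hu⟩
  obtain ⟨w, hw⟩ := Finset.card_pos.1 (h.odd hv).pos
  simp only [Finset.mem_filter, Finset.mem_univ, true_and] at hw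
  exact ⟨w, hw.1, fun z hz => (hmax z hz).trans_lt hw.2⟩

theorem Surrounds.asymm {X Y : Component a b} (h : Surrounds X Y) : ¬ Surrounds Y X := by
  intro h'
  obtain ⟨w, hw, h1⟩ := h.exists_gt
  obtain ⟨v, hv, h2⟩ := h'.exists_gt
  exact (h1 v hv).not_gt (h2 w hw)

/-- A vertex of Z lies in an interval of Y. No vertex of X can lie in that interval, since Y would
then surround X; so the parity with respect to X agrees with that at the end of the interval, a
vertex of Y. -/
theorem Surrounds.trans {X Y Z : Component a b} (h : Surrounds X Y) (h' : Surrounds Y Z) :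
    Surrounds X Z := by
  refine ⟨h.1, fun h1 => h.asymm (h1 ▸ h'), ?_⟩
  obtain ⟨hY, hne, z, hz, ho⟩ := h'
  obtain ⟨lo, hi, hp, h1, h2⟩ := hY.exists_isPair (Or.inr ho)
  refine ⟨z, hz, ?_⟩
  rw [countAbove_eq h2]
  · exact h.odd (isPair_iff.1 hp).2.1
  · intro u hu h3
    by_contra! h4
    have h5 : IsInterval Y lo hi := Or.inl ⟨hY, hp⟩
    exact h.asymm ((h5.inRegion (h1.trans h3.le) h4).surrounds hu h.2.1.symm)

/-- The definition tests the largest vertex of Y only; by the constancy of the parity any vertex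
will do. -/
theorem liesInside_iff {X Y : Component a b} : LiesInside Y X ↔ Surrounds X Y := by
  constructor
  · rintro ⟨hX, lo, hi, y, hp, hy, h1, h2⟩
    refine ⟨hX, ?_, y, hy.1, hp.odd_countAbove h1.le h2⟩
    rintro rfl
    rcases hp.eq_of_mem hy.1 h1.le h2.le with h3 | h3
    · exact h1.ne' h3
    · exact h2.ne h3
  · intro h
    obtain ⟨y, hy, hy1⟩ := exists_countAbove_eq Y (k := 0)
      ((Set.ncard_pos (Set.toFinite _)).2 Y.nonempty_supp)
    obtain ⟨lo, hi, hp, h1, h2⟩ := h.1.exists_isPair (Or.inr (h.odd hy))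
    have hy' := not_mem_supp h.2.1 hy
    obtain ⟨h3, h4, -⟩ := isPair_iff.1 hp
    exact ⟨h.1, lo, hi, y, hp, isNth_iff.2 ⟨hy, by omega⟩,
      lt_of_le_of_ne h1 fun h5 => hy' (h5 ▸ h3), lt_of_le_of_ne h2 fun h5 => hy' (h5 ▸ h4)⟩

/-- The component `X` lies inside no cycle. -/
def IsMaximal (X : Component a b) : Prop := ∀ Y : Component a b, ¬ LiesInside X Y

theorem exists_isMaximal (Y : Component a b) :
    ∃ X : Component a b, IsMaximal X ∧ (Y = X ∨ Surrounds X Y) := by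
  have : IsTrans (Component a b) Surrounds := ⟨fun _ _ _ h h' => h.trans h'⟩
  have : Std.Irrefl (Surrounds : Component a b → Component a b → Prop) :=
    ⟨fun _ h => h.asymm h⟩
  induction Y using (Finite.wellFounded_of_trans_of_irrefl
    (Surrounds : Component a b → Component a b → Prop)).induction with
  | _ Y ih =>
    by_cases h : IsMaximal Y
    · exact ⟨Y, h, Or.inl rfl⟩
    · simp only [IsMaximal, not_forall, not_not] at h
      obtain ⟨X, h⟩ := h
      rw [liesInside_iff] at h
      obtain ⟨Z, hZ, h'⟩ := ih X h
      refine ⟨Z, hZ, Or.inr ?_⟩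
      rcases h' with rfl | h'
      · exact h
      · exact h'.trans h

theorem exists_isMaximal_inRegion (a b : Composition n) (v : Fin n) :
    ∃ X : Component a b, IsMaximal X ∧ InRegion X v := by
  obtain ⟨X, hX, h⟩ := exists_isMaximal ((meanderGraph a b).connectedComponentMk v)
  refine ⟨X, hX, ?_⟩
  rcases h with h | h
  · exact Or.inl h
  · exact Or.inr ⟨h.1, h.odd rfl⟩

theorem IsMaximal.eq_of_inRegion {X Y : Component a b} (hX : IsMaximal X) (hY : IsMaximal Y)
    {v : Fin n} (h : InRegion X v) (h' : InRegion Y v) : X = Y := by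
  -- Of two intervals with a common point, the one that starts later has its first end, a vertex of
  -- its component, inside the other. Different components would therefore be nested, against
  -- maximality.
  have key : ∀ {X Y : Component a b} {lo hi lo' hi' : Fin n}, IsMaximal X → IsMaximal Y →
      IsInterval X lo hi → IsInterval Y lo' hi' → v ≤ hi → lo' ≤ v → lo ≤ lo' → X = Y := by
    intro X Y lo hi lo' hi' hX hY h1 h2 h3 h4 h5
    by_contra hne
    exact hY X (liesInside_iff.2 ((h1.inRegion h5 (h4.trans h3)).surrounds h2.lo_mem
      (Ne.symm hne)))
  obtain ⟨lo, hi, h1, h2, h3⟩ := h.exists_isInterval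
  obtain ⟨lo', hi', h1', h2', h3'⟩ := h'.exists_isInterval
  rcases le_total lo lo' with h4 | h4
  · exact key hX hY h1 h1' h3 h2' h4
  · exact (key hY hX h1' h1 h3' h2 h4).symm

theorem exists_root (a b : Composition n) (v : Fin n) :
    ∃ t : Component a b × Fin n × Fin n, IsMaximal t.1 ∧ IsInterval t.1 t.2.1 t.2.2 ∧
      t.2.1 ≤ v ∧ v ≤ t.2.2 := by
  obtain ⟨X, hX, h⟩ := exists_isMaximal_inRegion a b v
  obtain ⟨lo, hi, h⟩ := h.exists_isInterval
  exact ⟨(X, lo, hi), hX, h⟩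

variable (a b) in
/-- The maximal cycle with an interval containing `v`. -/
noncomputable def root (v : Fin n) : Component a b := (exists_root a b v).choose.1

variable (a b) in
/-- The first point of the interval containing `v`. -/
noncomputable def lo (v : Fin n) : Fin n := (exists_root a b v).choose.2.1

variable (a b) in
/-- The last point of the interval containing `v`. -/
noncomputable def hi (v : Fin n) : Fin n := (exists_root a b v).choose.2.2

theorem isMaximal_root (v : Fin n) : IsMaximal (root a b v) := (exists_root a b v).choose_spec.1

theorem isInterval_root (v : Fin n) : IsInterval (root a b v) (lo a b v) (hi a b v) :=
  (exists_root a b v).choose_spec.2.1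

theorem lo_le (v : Fin n) : lo a b v ≤ v := (exists_root a b v).choose_spec.2.2.1

theorem le_hi (v : Fin n) : v ≤ hi a b v := (exists_root a b v).choose_spec.2.2.2

theorem root_eq {X : Component a b} (hX : IsMaximal X) {l h v : Fin n} (hi : IsInterval X l h)
    (h1 : l ≤ v) (h2 : v ≤ h) : root a b v = X :=
  (isMaximal_root v).eq_of_inRegion hX ((isInterval_root v).inRegion (lo_le v) (le_hi v))
    (hi.inRegion h1 h2)

theorem lo_hi_eq {X : Component a b} (hX : IsMaximal X) {l h v : Fin n} (hi' : IsInterval X l h)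
    (h1 : l ≤ v) (h2 : v ≤ h) : lo a b v = l ∧ hi a b v = h := by
  have h3 := root_eq hX hi' h1 h2
  have h4 := isInterval_root (a := a) (b := b) v
  rw [h3] at h4
  exact h4.unique hi' (lo_le v) (le_hi v) h1 h2

theorem root_of_mem {X : Component a b} (hX : IsMaximal X) {v : Fin n} (hv : v ∈ X.supp) :
    root a b v = X := by
  have hr : InRegion X v := Or.inl hv
  obtain ⟨l, h, hi, h1, h2⟩ := hr.exists_isInterval
  exact root_eq hX hi h1 h2

theorem index_lo (hc : c = a ∨ c = b) (v : Fin n) : c.index (lo a b v) = c.index v := by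
  have h1 := (isInterval_root (a := a) (b := b) v).index_eq hc
  have h2 := index_mono c (lo_le (a := a) (b := b) v)
  have h3 := index_mono c (le_hi (a := a) (b := b) v)
  exact le_antisymm h2 (h1 ▸ h3)

theorem index_hi (hc : c = a ∨ c = b) (v : Fin n) : c.index (hi a b v) = c.index v := by
  rw [← (isInterval_root v).index_eq hc, index_lo hc]

theorem blockReflection_le {v w : Fin n} (h : c.index v = c.index w) :
    blockReflection c v ≤ blockReflection c w ↔ w ≤ v := by
  rw [← not_lt, blockReflection_lt c h.symm, not_lt]

theorem root_blockReflection (hc : c = a ∨ c = b) (v : Fin n) :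
    root a b (blockReflection c v) = root a b v :=
  root_eq (isMaximal_root v) ((isInterval_root v).blockReflection hc)
    ((blockReflection_le (index_hi hc v)).2 (le_hi v))
    ((blockReflection_le (index_lo hc v).symm).2 (lo_le v))

theorem lo_hi_blockReflection (hc : c = a ∨ c = b) (v : Fin n) :
    lo a b (blockReflection c v) = blockReflection c (hi a b v) ∧
      hi a b (blockReflection c v) = blockReflection c (lo a b v) :=
  lo_hi_eq (isMaximal_root v) ((isInterval_root v).blockReflection hc)
    ((blockReflection_le (index_hi hc v)).2 (le_hi v))
    ((blockReflection_le (index_lo hc v).symm).2 (lo_le v))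

theorem lo_hi_of_mem_Icc {v w : Fin n} (h1 : lo a b v ≤ w) (h2 : w ≤ hi a b v) :
    lo a b w = lo a b v ∧ hi a b w = hi a b v :=
  lo_hi_eq (isMaximal_root v) (isInterval_root v) h1 h2

theorem root_of_mem_Icc {v w : Fin n} (h1 : lo a b v ≤ w) (h2 : w ≤ hi a b v) :
    root a b w = root a b v :=
  root_eq (isMaximal_root v) (isInterval_root v) h1 h2

theorem lo_lo (v : Fin n) : lo a b (lo a b v) = lo a b v :=
  (lo_hi_of_mem_Icc le_rfl ((lo_le v).trans (le_hi v))).1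

theorem hi_lo (v : Fin n) : hi a b (lo a b v) = hi a b v :=
  (lo_hi_of_mem_Icc le_rfl ((lo_le v).trans (le_hi v))).2

theorem root_lo (v : Fin n) : root a b (lo a b v) = root a b v :=
  root_of_mem_Icc le_rfl ((lo_le v).trans (le_hi v))

theorem hi_eq_of_lo_eq {v w : Fin n} (h : lo a b v = lo a b w) : hi a b v = hi a b w := by
  rw [← hi_lo, h, hi_lo]

theorem root_eq_of_lo_eq {v w : Fin n} (h : lo a b v = lo a b w) : root a b v = root a b w := by
  rw [← root_lo, h, root_lo]

theorem lo_mono : Monotone (lo a b) := by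
  intro v w h
  by_contra! h1
  have h2 := lo_le (a := a) (b := b) v
  have h3 : lo a b v = lo a b w := (lo_hi_of_mem_Icc h1.le (h2.trans (h.trans (le_hi w)))).1 ▸
    (lo_lo v).symm
  exact h1.ne' h3

theorem hi_lt_lo {v w : Fin n} (h : lo a b v < lo a b w) : hi a b v < lo a b w := by
  by_contra! h1
  have := (lo_hi_of_mem_Icc h.le h1).1
  rw [lo_lo] at this
  exact h.ne' this

/-! ### Translations of intervals -/

variable (a b) in
/-- The reflection of the interval containing `v`. -/
noncomputable def intervalReflection (v : Fin n) : Fin n :=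
  ⟨lo a b v + hi a b v - v, by
    have h1 : (lo a b v : ℕ) ≤ v := lo_le v
    have h2 := (hi a b v).2
    omega⟩

theorem coe_intervalReflection (v : Fin n) :
    (intervalReflection a b v : ℕ) + v = lo a b v + hi a b v := by
  have h1 : (lo a b v : ℕ) ≤ v := lo_le v
  have h2 : (v : ℕ) ≤ hi a b v := le_hi v
  simp only [intervalReflection]
  omega

theorem intervalReflection_mem (v : Fin n) :
    lo a b v ≤ intervalReflection a b v ∧ intervalReflection a b v ≤ hi a b v := by
  have h1 : (lo a b v : ℕ) ≤ v := lo_le v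
  have h2 : (v : ℕ) ≤ hi a b v := le_hi v
  have h3 := coe_intervalReflection (a := a) (b := b) v
  simp only [Fin.le_def]
  omega

theorem lo_intervalReflection (v : Fin n) : lo a b (intervalReflection a b v) = lo a b v :=
  (lo_hi_of_mem_Icc (intervalReflection_mem v).1 (intervalReflection_mem v).2).1

theorem hi_intervalReflection (v : Fin n) : hi a b (intervalReflection a b v) = hi a b v :=
  (lo_hi_of_mem_Icc (intervalReflection_mem v).1 (intervalReflection_mem v).2).2

theorem root_intervalReflection (v : Fin n) :
    root a b (intervalReflection a b v) = root a b v :=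
  root_of_mem_Icc (intervalReflection_mem v).1 (intervalReflection_mem v).2

theorem intervalReflection_intervalReflection (v : Fin n) :
    intervalReflection a b (intervalReflection a b v) = v := by
  have h1 := coe_intervalReflection (a := a) (b := b) v
  have h2 := coe_intervalReflection (a := a) (b := b) (intervalReflection a b v)
  rw [lo_intervalReflection, hi_intervalReflection] at h2
  ext
  omega

theorem index_intervalReflection (hc : c = a ∨ c = b) (v : Fin n) :
    c.index (intervalReflection a b v) = c.index v := by
  rw [← index_lo hc, lo_intervalReflection, index_lo hc]

/-- Both maps are point reflections, and the block reflection carries the interval of v onto the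
interval of its image, end to end. -/
theorem intervalReflection_blockReflection (hc : c = a ∨ c = b) (v : Fin n) :
    intervalReflection a b (blockReflection c v) =
      blockReflection c (intervalReflection a b v) := by
  have h1 := coe_intervalReflection (a := a) (b := b) v
  have h2 := coe_intervalReflection (a := a) (b := b) (blockReflection c v)
  obtain ⟨h3, h4⟩ := lo_hi_blockReflection hc v
  have h5 := blockReflection_add c (index_lo hc v)
  have h6 := blockReflection_add c (index_hi hc v)
  have h7 := blockReflection_add c (index_intervalReflection hc v)
  rw [h3, h4] at h2
  ext
  omega

variable (a b c) in
/-- The order preserving involution on intervals which maps every interval to its reflection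
in the block of `c`. -/
noncomputable def shift (v : Fin n) : Fin n := blockReflection c (intervalReflection a b v)

theorem shift_shift (hc : c = a ∨ c = b) (v : Fin n) : shift a b c (shift a b c v) = v := by
  rw [shift, shift, intervalReflection_blockReflection hc, blockReflection_blockReflection,
    intervalReflection_intervalReflection]

theorem index_shift (hc : c = a ∨ c = b) (v : Fin n) : c.index (shift a b c v) = c.index v := by
  rw [shift, index_blockReflection, index_intervalReflection hc]

theorem lo_shift (hc : c = a ∨ c = b) (v : Fin n) :
    lo a b (shift a b c v) = blockReflection c (hi a b v) := by
  rw [shift, (lo_hi_blockReflection hc _).1, hi_intervalReflection]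

theorem root_shift (hc : c = a ∨ c = b) (v : Fin n) :
    root a b (shift a b c v) = root a b v := by
  rw [shift, root_blockReflection hc, root_intervalReflection]

/-- Translations preserve the position in the interval. -/
theorem shift_add (hc : c = a ∨ c = b) (v : Fin n) :
    (shift a b c v : ℕ) + lo a b v = lo a b (shift a b c v) + v := by
  rw [lo_shift hc, shift]
  have h1 := coe_intervalReflection (a := a) (b := b) v
  have h6 := blockReflection_add c (index_hi hc v)
  have h7 := blockReflection_add c (index_intervalReflection hc v)
  omega

end Interval

/-! ### Darts of a pair of involutions -/

section Dart

variable {V : Type*} {σ τ : V → V}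

/-- The arc which starts at `v`, of `σ` or of `τ`, traversed in the opposite direction. -/
def dartFlip (σ τ : V → V) (d : V × Bool) : V × Bool :=
  (if d.2 then σ d.1 else τ d.1, d.2)

/-- One step along a strand: the arc at the end point of the given one. -/
def dartStep (hσ : ∀ v, σ (σ v) = v) (hτ : ∀ v, τ (τ v) = v) : Equiv.Perm (V × Bool) where
  toFun d := (if d.2 then σ d.1 else τ d.1, !d.2)
  invFun d := (if d.2 then τ d.1 else σ d.1, !d.2)
  left_inv := by rintro ⟨v, _ | _⟩ <;> simp [hσ, hτ]
  right_inv := by rintro ⟨v, _ | _⟩ <;> simp [hσ, hτ]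

variable (hσ : ∀ v, σ (σ v) = v) (hτ : ∀ v, τ (τ v) = v)

include hσ hτ

/-- Reversing an arc turns the walk along the strand into the backward walk. -/
theorem dartStep_dartFlip_dartStep (d : V × Bool) :
    dartStep hσ hτ (dartFlip σ τ (dartStep hσ hτ d)) = dartFlip σ τ d := by
  rcases d with ⟨v, _ | _⟩ <;> simp [dartStep, dartFlip, hσ, hτ]

/-- If walking k steps reversed an arc, then k - 2 steps would reverse the next one. Descending, one
meets either an arc equal to its reverse, which is excluded, or k = 1, where the kinds of the arcs
differ. -/
theorem dartFlip_ne (k : ℕ) : ∀ d : V × Bool,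
    (∀ e, (dartStep hσ hτ).SameCycle d e → dartFlip σ τ e ≠ e) →
    dartFlip σ τ d ≠ (dartStep hσ hτ ^ k) d := by
  induction k using Nat.strong_induction_on with
  | _ k ih =>
    intro d hd h
    match k with
    | 0 => exact hd d (Equiv.Perm.SameCycle.refl _ _) h
    | 1 =>
      have := congrArg Prod.snd h
      rcases d with ⟨v, _ | _⟩ <;> simp [dartStep, dartFlip] at this
    | k + 2 =>
      refine ih k (by omega) (dartStep hσ hτ d)
        (fun e he => hd e (Equiv.Perm.sameCycle_apply_left.1 he)) ?_
      apply (dartStep hσ hτ).injective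
      rw [dartStep_dartFlip_dartStep hσ hτ, h, ← Equiv.Perm.mul_apply, ← Equiv.Perm.mul_apply,
        ← pow_succ', ← pow_succ]

/-- A strand without ends passes each point in one direction only: the dart at v of the other kind
comes right after the reverse of the first, so meeting it would mean meeting that reverse. -/
theorem not_sameCycle [Finite V] {d : V × Bool}
    (hd : ∀ e, (dartStep hσ hτ).SameCycle d e → dartFlip σ τ e ≠ e) {v : V}
    (h : (dartStep hσ hτ).SameCycle d (v, true)) : ¬ (dartStep hσ hτ).SameCycle d (v, false) := by
  intro h'
  obtain ⟨k, hk⟩ := (h.symm.trans h').exists_nat_pow_eq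
  have hd' : ∀ e, (dartStep hσ hτ).SameCycle (v, true) e → dartFlip σ τ e ≠ e :=
    fun e he => hd e (h.trans he)
  match k with
  | 0 => simp at hk
  | k + 1 =>
    refine dartFlip_ne hσ hτ k _ hd' ((dartStep hσ hτ).injective ?_)
    rw [← Equiv.Perm.mul_apply, ← pow_succ', hk]
    simp [dartStep, dartFlip, hσ]

end Dart

/-! ### The strands of a maximal cycle are not closed -/

section Strand

variable {n : ℕ} {a b : Composition n} {c : Composition n}

theorem intervalReflection_lo (v : Fin n) : intervalReflection a b (lo a b v) = hi a b v := by
  have h := coe_intervalReflection (a := a) (b := b) (lo a b v)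
  rw [lo_lo, hi_lo] at h
  ext
  omega

theorem shift_lo (hc : c = a ∨ c = b) (v : Fin n) :
    shift a b c (lo a b v) = lo a b (shift a b c v) := by
  rw [lo_shift hc, shift, intervalReflection_lo]

theorem shift_eq_self (hc : c = a ∨ c = b) {v : Fin n} (h : lo a b (shift a b c v) = lo a b v) :
    shift a b c v = v := by
  have := shift_add hc v
  rw [h] at this
  ext
  omega

variable (a b) in
/-- The step along the strands of intervals. -/
noncomputable def strandStep : Equiv.Perm (Fin n × Bool) :=
  dartStep (shift_shift (a := a) (b := b) (c := a) (Or.inl rfl))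
    (shift_shift (a := a) (b := b) (c := b) (Or.inr rfl))

theorem root_strandStep_pow (k : ℕ) (d : Fin n × Bool) :
    root a b ((strandStep a b ^ k) d).1 = root a b d.1 := by
  induction k with
  | zero => rfl
  | succ k ih =>
    rw [pow_succ', Equiv.Perm.mul_apply, ← ih]
    generalize (strandStep a b ^ k) d = e
    rcases e with ⟨v, _ | _⟩
    · exact root_shift (Or.inr rfl) v
    · exact root_shift (Or.inl rfl) v

/-- On a strand without ends the darts split its points into two disjoint classes `W true` and `W
false`, exchanged by every translation. This orients the boundary of the strand and leads to a
contradiction with the connectedness of X. -/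
theorem exists_strandStep_fixed {v : Fin n} (hv : lo a b v = v) (x : Bool) :
    ∃ k : ℕ, dartFlip (shift a b a) (shift a b b) ((strandStep a b ^ k) (v, x)) =
      (strandStep a b ^ k) (v, x) := by
  by_contra! hno
  have hd : ∀ e, (strandStep a b).SameCycle (v, x) e →
      dartFlip (shift a b a) (shift a b b) e ≠ e := by
    intro e he
    obtain ⟨k, rfl⟩ := he.exists_nat_pow_eq
    exact hno k
  let W : Bool → Set (Fin n) := fun y => {u | (strandStep a b).SameCycle (v, x) (u, y)}
  have hdisj : ∀ u, u ∈ W true → u ∉ W false := fun u h => not_sameCycle _ _ hd h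
  have hWa : ∀ y u, u ∈ W y → shift a b a u ∈ W !y := by
    intro y u hu
    cases y
    · refine Equiv.Perm.sameCycle_apply_right.1 (?_ : (strandStep a b).SameCycle (v, x) _)
      have : strandStep a b (shift a b a u, true) = (u, false) := by
        simp [strandStep, dartStep, shift_shift]
      rw [Bool.not_false, this]
      exact hu
    · exact Equiv.Perm.sameCycle_apply_right.2 hu
  have hWb : ∀ y u, u ∈ W y → shift a b b u ∈ W !y := by
    intro y u hu
    cases y
    · exact Equiv.Perm.sameCycle_apply_right.2 hu
    · refine Equiv.Perm.sameCycle_apply_right.1 (?_ : (strandStep a b).SameCycle (v, x) _)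
      have : strandStep a b (shift a b b u, false) = (u, true) := by
        simp [strandStep, dartStep, shift_shift]
      rw [Bool.not_true, this]
      exact hu
  have hW : ∀ c, c = a ∨ c = b → ∀ y u, u ∈ W y → shift a b c u ∈ W !y := by
    rintro c (rfl | rfl)
    · exact hWa
    · exact hWb
  have hne : ∀ y u, u ∈ W y → u ∉ W !y := by
    rintro (_ | _) u h h'
    · exact hdisj u h' h
    · exact hdisj u h h'
  set X := root a b v with hX
  have hvX : v ∈ X.supp := by
    have := (isInterval_root (a := a) (b := b) v).lo_mem
    rwa [hv] at this
  -- Following X from v, lower and upper ends alternate together with the two classes: a block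
  -- reflection takes lower ends to upper ends, and its effect on the lower end of the interval is
  -- the translation.
  have key : ∀ u ∈ X.supp, (u ∈ W x ∧ lo a b u = u) ∨
      (intervalReflection a b u ∈ W (!x) ∧
        lo a b (intervalReflection a b u) = intervalReflection a b u) := by
    intro u hu
    refine component_induction (P := fun u => (u ∈ W x ∧ lo a b u = u) ∨
      (intervalReflection a b u ∈ W (!x) ∧
        lo a b (intervalReflection a b u) = intervalReflection a b u)) ?_ hvX hu
      (Or.inl ⟨Equiv.Perm.SameCycle.refl _ _, hv⟩)
    rintro c hc w - (⟨h1, h2⟩ | ⟨h1, h2⟩)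
    · right
      rw [intervalReflection_blockReflection hc]
      refine ⟨hW c hc _ _ h1, ?_⟩
      change lo a b (shift a b c w) = shift a b c w
      rw [← shift_lo hc, h2]
    · left
      have h3 : blockReflection c w = shift a b c (intervalReflection a b w) := by
        rw [shift, intervalReflection_intervalReflection]
      rw [h3]
      refine ⟨?_, by rw [← shift_lo hc, h2]⟩
      have := hW c hc _ _ h1
      rwa [Bool.not_not] at this
  have hvW : v ∈ W x := Equiv.Perm.SameCycle.refl _ _
  have hint := isInterval_root (a := a) (b := b) v
  rw [hv, ← hX] at hint
  -- For a cycle, the upper end of the interval of v is also on X; this would put v itself into both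
  -- classes. For a segment, intervals are points, so a vertex fixed by a reflection would be in
  -- both classes; hence all valencies are two and the segment is a cycle.
  by_cases hcyc : IsCycle X
  · have hlt : v < hi a b v := by
      rcases hint with ⟨-, h⟩ | ⟨h, -⟩
      · exact h.lt
      · exact absurd hcyc h
    have hrev : intervalReflection a b (hi a b v) = v := by
      rw [← intervalReflection_lo, intervalReflection_intervalReflection, hv]
    rcases key _ hint.hi_mem with ⟨-, h⟩ | ⟨h, -⟩
    · rw [(lo_hi_of_mem_Icc ((lo_le v).trans (le_hi v)) le_rfl).1, hv] at h
      exact hlt.ne h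
    · rw [hrev] at h
      exact hne _ _ hvW h
  · refine hcyc fun u hu => ?_
    have hrev : intervalReflection a b u = u := by
      have h1 := isInterval_root (a := a) (b := b) u
      rw [root_of_mem (isMaximal_root v) hu, ← hX] at h1
      rcases h1 with ⟨h1, -⟩ | ⟨-, -, h1⟩
      · exact absurd h1 hcyc
      · have h2 := coe_intervalReflection (a := a) (b := b) u
        have h3 := le_antisymm (h1 ▸ le_hi (a := a) (b := b) u) (lo_le (a := a) (b := b) u)
        rw [h1, ← h3] at h2
        ext
        omega
    have hmem : ∃ y, u ∈ W y := by
      rcases key u hu with h | h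
      · exact ⟨_, h.1⟩
      · rw [hrev] at h
        exact ⟨_, h.1⟩
    obtain ⟨y, hy⟩ := hmem
    have hfix : ∀ c, c = a ∨ c = b → blockReflection c u ≠ u := by
      intro c hc h
      have h1 := hW c hc y u hy
      rw [shift, hrev, h] at h1
      exact hne _ _ hy h1
    rw [valency, if_pos (hfix a (Or.inl rfl)), if_pos (hfix b (Or.inr rfl))]

/-- Some interval of a maximal cycle is mapped to itself by one of the two reflections. -/
theorem exists_shift_eq {X : Component a b} (hX : IsMaximal X) :
    ∃ c, (c = a ∨ c = b) ∧ ∃ v, root a b v = X ∧ shift a b c v = v := by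
  obtain ⟨w, hw⟩ := X.nonempty_supp
  have hr := root_of_mem hX hw
  obtain ⟨k, hk⟩ := exists_strandStep_fixed (a := a) (b := b) (lo_lo w) true
  have h1 := root_strandStep_pow (a := a) (b := b) k (lo a b w, true)
  rw [root_lo, hr] at h1
  generalize (strandStep a b ^ k) (lo a b w, true) = e at hk h1
  rcases e with ⟨v, _ | _⟩
  · exact ⟨b, Or.inr rfl, v, h1, congrArg Prod.fst hk⟩
  · exact ⟨a, Or.inl rfl, v, h1, congrArg Prod.fst hk⟩

open Classical in
variable (a b) in
/-- The number of steps along a strand, starting with the given arc, up to its end. -/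
noncomputable def strandHeight (v : Fin n) (x : Bool) : ℕ :=
  Nat.find (exists_strandStep_fixed (lo_lo (a := a) (b := b) v) x)

theorem strandHeight_lt {v : Fin n} {x : Bool} {w : Fin n}
    (hw : strandStep a b (lo a b v, x) = (lo a b w, !x)) (hne : lo a b w ≠ lo a b v) :
    strandHeight a b w (!x) < strandHeight a b v x := by
  classical
  have h1 := Nat.find_spec (exists_strandStep_fixed (lo_lo (a := a) (b := b) v) x)
  change dartFlip _ _ ((strandStep a b ^ strandHeight a b v x) _) =
    (strandStep a b ^ strandHeight a b v x) _ at h1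
  cases hk : strandHeight a b v x with
  | zero =>
    rw [hk, pow_zero, Equiv.Perm.one_apply] at h1
    have h2 := congrArg Prod.fst h1
    have h3 := congrArg Prod.fst hw
    exact absurd (h3.symm.trans h2) hne
  | succ k =>
    rw [hk, pow_succ, Equiv.Perm.mul_apply, hw] at h1
    exact Nat.lt_succ_of_le (Nat.find_min' _ h1)

variable (a b) in
/-- The strand system of the intervals of the maximal cycles. -/
noncomputable def strandSystem : StrandSystem (Fin n) where
  κ v := lo a b v
  A v := a.index v
  B v := b.index v
  σ := shift a b a
  τ := shift a b b
  ha v := strandHeight a b v true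
  hb v := strandHeight a b v false
  σ_σ := shift_shift (Or.inl rfl)
  τ_τ := shift_shift (Or.inr rfl)
  A_σ v := by rw [index_shift (Or.inl rfl)]
  B_τ v := by rw [index_shift (Or.inr rfl)]
  σ_lt p q h h' := by
    have hc : a = a ∨ a = b := Or.inl rfl
    rw [lo_shift hc, lo_shift hc, Nat.cast_lt, Fin.val_fin_lt, blockReflection_lt]
    · exact (hi_lt_lo (by exact_mod_cast h')).trans_le ((lo_le q).trans (le_hi q))
    · rw [index_hi hc, index_hi hc]
      exact (Fin.ext h).symm
  τ_lt p q h h' := by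
    have hc : b = a ∨ b = b := Or.inr rfl
    rw [lo_shift hc, lo_shift hc, Nat.cast_lt, Fin.val_fin_lt, blockReflection_lt]
    · exact (hi_lt_lo (by exact_mod_cast h')).trans_le ((lo_le q).trans (le_hi q))
    · rw [index_hi hc, index_hi hc]
      exact (Fin.ext h).symm
  σ_eq p q h := by
    rw [lo_shift (Or.inl rfl), lo_shift (Or.inl rfl), hi_eq_of_lo_eq (Fin.ext (by exact_mod_cast h))]
  τ_eq p q h := by
    rw [lo_shift (Or.inr rfl), lo_shift (Or.inr rfl), hi_eq_of_lo_eq (Fin.ext (by exact_mod_cast h))]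
  A_eq p q h := by
    rw [← index_lo (a := a) (b := b) (Or.inl rfl) p, ← index_lo (a := a) (b := b) (Or.inl rfl) q,
      show lo a b p = lo a b q from Fin.ext (by exact_mod_cast h)]
  B_eq p q h := by
    rw [← index_lo (a := a) (b := b) (Or.inr rfl) p, ← index_lo (a := a) (b := b) (Or.inr rfl) q,
      show lo a b p = lo a b q from Fin.ext (by exact_mod_cast h)]
  σ_fix p h := shift_eq_self (Or.inl rfl) (Fin.ext (by exact_mod_cast h))
  τ_fix p h := shift_eq_self (Or.inr rfl) (Fin.ext (by exact_mod_cast h))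
  ha_lt p h := strandHeight_lt (x := true) (Prod.ext (shift_lo (Or.inl rfl) p) rfl)
    fun h' => h (by rw [h'])
  hb_lt p h := strandHeight_lt (x := false) (Prod.ext (shift_lo (Or.inr rfl) p) rfl)
    fun h' => h (by rw [h'])

/-! ### The dimension of a maximal cycle -/

/-- The reflections carry X and Y along together, and they connect all ends of intervals of X; so a
surrounded component meets every interval if it meets one. -/
theorem exists_mem_lo_eq {X Y : Component a b} (hX : IsMaximal X) (h : Surrounds X Y) {v : Fin n}
    (hv : root a b v = X) : ∃ w ∈ Y.supp, lo a b w = lo a b v := by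
  obtain ⟨y, hy⟩ := Y.nonempty_supp
  have hy' : root a b y = X :=
    (isMaximal_root y).eq_of_inRegion hX
      ((isInterval_root y).inRegion (lo_le y) (le_hi y)) (Or.inr ⟨h.1, h.odd hy⟩)
  have h1 : lo a b y ∈ X.supp := hy' ▸ (isInterval_root y).lo_mem
  have h2 : lo a b v ∈ X.supp := hv ▸ (isInterval_root v).lo_mem
  have h3 := component_induction (P := fun u => ∃ w ∈ Y.supp, lo a b w = lo a b u) ?_ h1 h2
    ⟨y, hy, (lo_lo y).symm⟩
  · simpa only [lo_lo] using h3
  · rintro c hc u - ⟨w, hw, hwu⟩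
    refine ⟨blockReflection c w, (blockReflection_mem hc Y).2 hw, ?_⟩
    rw [(lo_hi_blockReflection hc _).1, (lo_hi_blockReflection hc _).1, hi_eq_of_lo_eq hwu]

/-- Along a component the distance to one end of the interval is preserved, a block reflection
exchanging the lower and the upper end. -/
theorem eq_or_eq_intervalReflection {Y : Component a b} {v w : Fin n} (hv : v ∈ Y.supp)
    (hw : w ∈ Y.supp) (h : lo a b w = lo a b v) : w = v ∨ w = intervalReflection a b v := by
  have h1 := component_induction (P := fun u : Fin n =>
    (u : ℕ) + lo a b v = v + lo a b u ∨ (hi a b u : ℕ) + lo a b v = v + u) ?_ hv hw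
    (Or.inl rfl)
  · have h2 := hi_eq_of_lo_eq h
    have h3 := coe_intervalReflection (a := a) (b := b) v
    rw [h, h2] at h1
    simp only [Fin.ext_iff]
    omega
  · intro c hc u _ hu
    have h2 := blockReflection_add c (index_lo hc u)
    have h3 := blockReflection_add c (index_hi hc u)
    rw [(lo_hi_blockReflection hc _).1, (lo_hi_blockReflection hc _).2]
    omega

/-- At the end of the strand the block reflection folds the interval onto itself, and Y passes
through that interval. -/
theorem exists_blockReflection_eq {X Y : Component a b} (hX : IsMaximal X) (h : Surrounds X Y) :
    ∃ c, (c = a ∨ c = b) ∧ ∃ v ∈ Y.supp, intervalReflection a b v = blockReflection c v := by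
  obtain ⟨c, hc, u, hu, hfix⟩ := exists_shift_eq hX
  obtain ⟨w, hw, hwu⟩ := exists_mem_lo_eq hX h hu
  refine ⟨c, hc, w, hw, ?_⟩
  have h1 : shift a b c w = w := by
    apply shift_eq_self hc
    rw [← shift_lo hc, hwu, shift_lo hc, hfix]
  rw [← h1]
  nth_rewrite 2 [shift]
  rw [blockReflection_blockReflection, h1]

theorem intervalReflection_mem_supp {X Y : Component a b} (hX : IsMaximal X) (h : Surrounds X Y)
    {v : Fin n} (hv : v ∈ Y.supp) : intervalReflection a b v ∈ Y.supp := by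
  obtain ⟨c, hc, w, hw, hcw⟩ := exists_blockReflection_eq hX h
  refine component_induction (P := fun u => intervalReflection a b u ∈ Y.supp) ?_ hw hv ?_
  · intro c hc u _ hu
    rw [intervalReflection_blockReflection hc]
    exact (blockReflection_mem hc Y).2 hu
  · rw [hcw]
    exact (blockReflection_mem hc Y).2 hw

/-- Being the midpoint of its interval is a property shared by all vertices of Y. A midpoint is
fixed by the block reflection at the end of the strand; conversely a vertex fixed by a block
reflection has its interval folded onto itself and is the midpoint. -/
theorem isCycle_iff_intervalReflection_ne {X Y : Component a b} (hX : IsMaximal X)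
    (h : Surrounds X Y) {v : Fin n} (hv : v ∈ Y.supp) :
    IsCycle Y ↔ intervalReflection a b v ≠ v := by
  have key : ∀ {u w}, u ∈ Y.supp → w ∈ Y.supp → intervalReflection a b u = u →
      intervalReflection a b w = w := by
    intro u w hu hw
    refine component_induction (P := fun u => intervalReflection a b u = u) ?_ hu hw
    intro c hc x _ hx
    rw [intervalReflection_blockReflection hc, hx]
  constructor
  · intro hY h1
    obtain ⟨c, hc, w, hw, hcw⟩ := exists_blockReflection_eq hX h
    exact hY.blockReflection_ne hc hw (hcw.symm.trans (key hv hw h1))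
  · intro h1 u hu
    have hfix : ∀ c, c = a ∨ c = b → blockReflection c u ≠ u := by
      intro c hc h2
      have h3 : shift a b c u = u := by
        apply shift_eq_self hc
        rw [lo_shift hc, ← (lo_hi_blockReflection hc u).1, h2]
      apply h1
      refine key hu hv ?_
      rw [shift] at h3
      rw [← blockReflection_blockReflection c (intervalReflection a b u), h3, h2]
    rw [valency, if_pos (hfix a (Or.inl rfl)), if_pos (hfix b (Or.inr rfl))]

/-- The intervals of a maximal cycle `X` have `dimension X` points. -/
theorem hi_add_one (v : Fin n) :
    (hi a b v : ℕ) + 1 = lo a b v + dimension (root a b v) := by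
  classical
  set X := root a b v with hX
  have hmax : IsMaximal X := isMaximal_root v
  have hint := isInterval_root (a := a) (b := b) v
  rw [← hX] at hint
  by_cases hcyc : IsCycle X
  · rw [dimension, if_pos hcyc]
    have hlt : lo a b v < hi a b v := by
      rcases hint with ⟨-, h⟩ | ⟨h, -⟩
      · exact h.lt
      · exact absurd hcyc h
    -- The interior of an interval is sorted by components: each surrounded component meets it in a
    -- point and its mirror image, which are two points for a cycle and one for a segment. The two
    -- ends account for the summand 2 of the dimension.
    have h1 : (Finset.Ioo (lo a b v) (hi a b v)).card =
        ∑ Y ∈ Finset.univ.filter (fun Y : Component a b => Surrounds X Y),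
          if IsCycle Y then 2 else 1 := by
      rw [Finset.card_eq_sum_card_fiberwise (f := (meanderGraph a b).connectedComponentMk)
        (t := Finset.univ.filter fun Y : Component a b => Surrounds X Y)]
      · refine Finset.sum_congr rfl fun Y hY => ?_
        have hY : Surrounds X Y := (Finset.mem_filter.1 hY).2
        obtain ⟨w, hw, hwv⟩ := exists_mem_lo_eq hmax hY (rfl : root a b v = X)
        have h2 : (Finset.Ioo (lo a b v) (hi a b v)).filter
            (fun u => (meanderGraph a b).connectedComponentMk u = Y) =
            {w, intervalReflection a b w} := by
          ext u
          simp only [Finset.mem_filter, Finset.mem_Ioo, Finset.mem_insert, Finset.mem_singleton]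
          constructor
          · rintro ⟨⟨h3, h4⟩, h5⟩
            refine eq_or_eq_intervalReflection hw h5 ?_
            rw [hwv, (lo_hi_of_mem_Icc h3.le h4.le).1]
          · intro h3
            have h4 : u ∈ Y.supp := by
              rcases h3 with rfl | rfl
              · exact hw
              · exact intervalReflection_mem_supp hmax hY hw
            have h5 : lo a b u = lo a b v := by
              rcases h3 with rfl | rfl
              · exact hwv
              · rw [lo_intervalReflection, hwv]
            have h6 := not_mem_supp hY.2.1 h4
            have h7 := lo_le (a := a) (b := b) u
            have h8 := le_hi (a := a) (b := b) u
            rw [h5] at h7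
            rw [hi_eq_of_lo_eq h5] at h8
            exact ⟨⟨lt_of_le_of_ne h7 fun h => h6 (h ▸ hint.lo_mem),
              lt_of_le_of_ne h8 fun h => h6 (h ▸ hint.hi_mem)⟩, h4⟩
        rw [h2]
        have h3 := isCycle_iff_intervalReflection_ne hmax hY hw
        split_ifs with h4
        · exact Finset.card_pair (h3.1 h4).symm
        · rw [not_not.1 (mt h3.2 h4), Finset.pair_eq_singleton, Finset.card_singleton]
      · intro u hu
        have hu := Finset.mem_Ioo.1 (Finset.mem_coe.1 hu)
        simp only [Finset.coe_filter, Finset.mem_univ, true_and]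
        refine (hint.inRegion hu.1.le hu.2.le).surrounds (Y := _) rfl ?_
        intro h
        rcases hint.eq_of_mem (h : u ∈ X.supp) hu.1.le hu.2.le with h5 | h5
        · exact hu.1.ne' h5
        · exact hu.2.ne h5
    rw [Finset.sum_ite, Finset.sum_const, Finset.sum_const, Finset.filter_filter,
      Finset.filter_filter, Fin.card_Ioo] at h1
    have h2 : {Y : Component a b | IsCycle Y ∧ LiesInside Y X}.ncard =
        (Finset.univ.filter fun Y : Component a b => Surrounds X Y ∧ IsCycle Y).card := by
      rw [← Set.ncard_coe_finset]
      congr 1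
      ext Y
      simp [liesInside_iff, and_comm]
    have h3 : {Y : Component a b | ¬ IsCycle Y ∧ LiesInside Y X}.ncard =
        (Finset.univ.filter fun Y : Component a b => Surrounds X Y ∧ ¬ IsCycle Y).card := by
      rw [← Set.ncard_coe_finset]
      congr 1
      ext Y
      simp [liesInside_iff, and_comm]
    rw [h2, h3]
    have h4 : (lo a b v : ℕ) < hi a b v := hlt
    simp only [smul_eq_mul] at h1
    omega
  · rw [dimension, if_neg hcyc]
    rcases hint with ⟨h, -⟩ | ⟨-, -, h⟩
    · exact absurd h hcyc
    · rw [h]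

end Strand

/-! ### Block diagonal matrices over the intervals of the maximal cycles -/

section Block

variable {n : ℕ} {a b : Composition n} {c : Composition n}

theorem sub_lo_lt (v : Fin n) : (v : ℕ) - lo a b v < dimension (root a b v) := by
  have h1 := hi_add_one (a := a) (b := b) v
  have h2 : (v : ℕ) ≤ hi a b v := le_hi v
  have h3 : (lo a b v : ℕ) ≤ v := lo_le v
  omega

variable (a b) in
/-- The maximal cycle whose intervals contain `v`. -/
noncomputable def maximalRoot (v : Fin n) : MaximalCycle a b := ⟨root a b v, isMaximal_root v⟩

/-- The position of `v` in the interval of `X` containing it. -/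
noncomputable def position (X : MaximalCycle a b) (v : Fin n) (h : maximalRoot a b v = X) :
    Fin (dimension X.1) :=
  ⟨v - lo a b v, by subst h; exact sub_lo_lt v⟩

theorem maximalRoot_eq_of_lo_eq {v w : Fin n} (h : lo a b v = lo a b w) :
    maximalRoot a b v = maximalRoot a b w :=
  Subtype.ext (root_eq_of_lo_eq h)

theorem position_inj {X : MaximalCycle a b} {v w : Fin n} (hv : maximalRoot a b v = X)
    (hw : maximalRoot a b w = X) (h : lo a b v = lo a b w) :
    position X v hv = position X w hw ↔ v = w := by
  have h2 : (lo a b v : ℕ) ≤ v := lo_le v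
  have h3 : (lo a b w : ℕ) ≤ w := lo_le w
  have h4 := congrArg Fin.val h
  simp only [position, Fin.ext_iff]
  omega

/-- The `i`-th point of the interval of `X` containing `v`. -/
noncomputable def point (X : MaximalCycle a b) (v : Fin n) (h : maximalRoot a b v = X)
    (i : Fin (dimension X.1)) : Fin n :=
  ⟨lo a b v + i, by
    subst h
    have h1 := hi_add_one (a := a) (b := b) v
    have h2 := (hi a b v).2
    have h3 : (i : ℕ) < dimension (root a b v) := i.2
    omega⟩

theorem lo_point {X : MaximalCycle a b} {v : Fin n} (h : maximalRoot a b v = X)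
    (i : Fin (dimension X.1)) : lo a b (point X v h i) = lo a b v := by
  refine (lo_hi_of_mem_Icc ?_ ?_).1
  · simp [Fin.le_def, point]
  · subst h
    have h1 := hi_add_one (a := a) (b := b) v
    have h3 : (i : ℕ) < dimension (root a b v) := i.2
    simp only [Fin.le_def, point]
    omega

theorem maximalRoot_point {X : MaximalCycle a b} {v : Fin n} (h : maximalRoot a b v = X)
    (i : Fin (dimension X.1)) : maximalRoot a b (point X v h i) = X :=
  (maximalRoot_eq_of_lo_eq (lo_point h i)).trans h

theorem position_point {X : MaximalCycle a b} {v : Fin n} (h : maximalRoot a b v = X)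
    (i : Fin (dimension X.1)) : position X (point X v h i) (maximalRoot_point h i) = i := by
  have h1 := congrArg Fin.val (lo_point h i)
  ext
  simp only [position, h1]
  simp [point]

theorem point_injective {X : MaximalCycle a b} {v : Fin n} (h : maximalRoot a b v = X) :
    Function.Injective (point X v h) := by
  intro i j hij
  have h1 := congrArg Fin.val hij
  simp only [point] at h1
  ext
  omega

theorem point_position {X : MaximalCycle a b} {v w : Fin n} (h : maximalRoot a b v = X)
    (hw : maximalRoot a b w = X) (hlo : lo a b w = lo a b v) :
    point X v h (position X w hw) = w := by
  have h3 : (lo a b w : ℕ) ≤ w := lo_le w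
  have h4 := congrArg Fin.val hlo
  ext
  simp only [point, position]
  omega

variable (a b) in
/-- Families of square matrices of the sizes of the maximal cycles. -/
abbrev BlockFamily : Type :=
  ∀ X : MaximalCycle a b, Matrix (Fin (dimension X.1)) (Fin (dimension X.1)) ℂ

open Classical in
/-- The block diagonal matrix with block `f X` over every interval of `X`. -/
noncomputable def blockMatrix (f : BlockFamily a b) : Matrix (Fin n) (Fin n) ℂ := fun p q =>
  if h : lo a b q = lo a b p then
    f (maximalRoot a b p) (position _ p rfl) (position _ q (maximalRoot_eq_of_lo_eq h))
  else 0

theorem blockMatrix_apply (f : BlockFamily a b) {X : MaximalCycle a b} {p q : Fin n}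
    (hp : maximalRoot a b p = X) (hq : maximalRoot a b q = X) (h : lo a b p = lo a b q) :
    blockMatrix f p q = f X (position X p hp) (position X q hq) := by
  subst hp
  rw [blockMatrix, dif_pos h.symm]

theorem blockMatrix_apply_of_ne (f : BlockFamily a b) {p q : Fin n} (h : lo a b p ≠ lo a b q) :
    blockMatrix f p q = 0 := by
  rw [blockMatrix, dif_neg h.symm]

theorem blockMatrix_point (f : BlockFamily a b) {X : MaximalCycle a b} {v : Fin n}
    (h : maximalRoot a b v = X) (i j : Fin (dimension X.1)) :
    blockMatrix f (point X v h i) (point X v h j) = f X i j := by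
  rw [blockMatrix_apply f (maximalRoot_point h i) (maximalRoot_point h j)
    (by rw [lo_point, lo_point]), position_point, position_point]

theorem blockMatrix_one : blockMatrix (1 : BlockFamily a b) = 1 := by
  ext p q
  by_cases h : lo a b p = lo a b q
  · have hq := (maximalRoot_eq_of_lo_eq h).symm
    rw [blockMatrix_apply _ rfl hq h, Pi.one_apply, Matrix.one_apply, Matrix.one_apply]
    simp only [position_inj rfl hq h]
  · rw [blockMatrix_apply_of_ne _ h, Matrix.one_apply_ne]
    rintro rfl
    exact h rfl

theorem blockMatrix_add (f g : BlockFamily a b) :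
    blockMatrix (f + g) = blockMatrix f + blockMatrix g := by
  ext p q
  by_cases h : lo a b p = lo a b q
  · have hq := (maximalRoot_eq_of_lo_eq h).symm
    simp only [Matrix.add_apply, blockMatrix_apply _ rfl hq h, Pi.add_apply]
  · simp only [Matrix.add_apply, blockMatrix_apply_of_ne _ h, add_zero]

theorem blockMatrix_smul (z : ℂ) (f : BlockFamily a b) :
    blockMatrix (z • f) = z • blockMatrix f := by
  ext p q
  by_cases h : lo a b p = lo a b q
  · have hq := (maximalRoot_eq_of_lo_eq h).symm
    simp only [Matrix.smul_apply, blockMatrix_apply _ rfl hq h, Pi.smul_apply]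
  · simp only [Matrix.smul_apply, blockMatrix_apply_of_ne _ h, smul_zero]

theorem blockMatrix_mul (f g : BlockFamily a b) :
    blockMatrix (f * g) = blockMatrix f * blockMatrix g := by
  ext p q
  rw [Matrix.mul_apply]
  by_cases h : lo a b p = lo a b q
  · have hq := (maximalRoot_eq_of_lo_eq h).symm
    rw [blockMatrix_apply _ rfl hq h, Pi.mul_apply, Matrix.mul_apply]
    refine Fintype.sum_of_injective (point _ p rfl) (point_injective rfl) _ _ ?_ ?_
    · intro k hk
      rw [blockMatrix_apply_of_ne, zero_mul]
      intro hlo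
      exact hk ⟨position _ k (maximalRoot_eq_of_lo_eq hlo).symm, point_position _ _ hlo.symm⟩
    · intro i
      rw [blockMatrix_apply f rfl (maximalRoot_point rfl i) (lo_point rfl i).symm,
        blockMatrix_apply g (maximalRoot_point rfl i) hq ((lo_point rfl i).trans h),
        position_point]
  · rw [blockMatrix_apply_of_ne _ h]
    symm
    refine Finset.sum_eq_zero fun k _ => ?_
    by_cases hk : lo a b p = lo a b k
    · rw [blockMatrix_apply_of_ne g (fun h' => h (hk.trans h')), mul_zero]
    · rw [blockMatrix_apply_of_ne f hk, zero_mul]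

theorem exists_maximalRoot_eq (X : MaximalCycle a b) : ∃ v, maximalRoot a b v = X := by
  obtain ⟨v, hv⟩ := X.1.nonempty_supp
  exact ⟨v, Subtype.ext (root_of_mem X.2 hv)⟩

theorem blockMatrix_injective : Function.Injective (blockMatrix : BlockFamily a b → _) := by
  intro f g h
  funext X
  obtain ⟨v, hv⟩ := exists_maximalRoot_eq X
  ext i j
  rw [← blockMatrix_point f hv, h, blockMatrix_point]

theorem position_shift (hc : c = a ∨ c = b) {X : MaximalCycle a b} {v : Fin n}
    (hv : maximalRoot a b v = X) (hv' : maximalRoot a b (shift a b c v) = X) :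
    position X (shift a b c v) hv' = position X v hv := by
  have h1 := shift_add hc v
  have h2 : (lo a b v : ℕ) ≤ v := lo_le v
  ext
  simp only [position]
  omega

theorem lo_shift_eq (hc : c = a ∨ c = b) {p q : Fin n} (h : lo a b p = lo a b q) :
    lo a b (shift a b c p) = lo a b (shift a b c q) := by
  rw [lo_shift hc, lo_shift hc, hi_eq_of_lo_eq h]

theorem blockMatrix_shift (hc : c = a ∨ c = b) (f : BlockFamily a b) {p q : Fin n}
    (h : lo a b p = lo a b q) :
    blockMatrix f (shift a b c p) (shift a b c q) = blockMatrix f p q := by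
  have hq := (maximalRoot_eq_of_lo_eq h).symm
  have hp' : maximalRoot a b (shift a b c p) = maximalRoot a b p := Subtype.ext (root_shift hc p)
  have hq' : maximalRoot a b (shift a b c q) = maximalRoot a b p :=
    (Subtype.ext (root_shift hc q) : _ = maximalRoot a b q).trans hq
  rw [blockMatrix_apply f hp' hq' (lo_shift_eq hc h), blockMatrix_apply f rfl hq h,
    position_shift hc rfl, position_shift hc hq]

/-- Block diagonal matrices invariant under translations of intervals have the same blocks over all
intervals of a maximal cycle. -/
theorem exists_blockMatrix_eq {M : Matrix (Fin n) (Fin n) ℂ}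
    (h0 : ∀ p q, lo a b p ≠ lo a b q → M p q = 0)
    (h1 : ∀ c, c = a ∨ c = b → ∀ p q, lo a b p = lo a b q →
      M (shift a b c p) (shift a b c q) = M p q) :
    ∃ f : BlockFamily a b, blockMatrix f = M := by
  choose v hv using exists_maximalRoot_eq (a := a) (b := b)
  refine ⟨fun X => M.submatrix (point X (v X) (hv X)) (point X (v X) (hv X)), ?_⟩
  ext p q
  by_cases h : lo a b p = lo a b q
  · have hq := (maximalRoot_eq_of_lo_eq h).symm
    rw [blockMatrix_apply _ rfl hq h, Matrix.submatrix_apply]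
    set X := maximalRoot a b p with hX
    have hp1 : lo a b p ∈ X.1.supp := (isInterval_root p).lo_mem
    have hv1 : lo a b (v X) ∈ X.1.supp := by
      have h2 : root a b (v X) = X.1 := congrArg Subtype.val (hv X)
      rw [← h2]
      exact (isInterval_root (v X)).lo_mem
    -- The entries at given offsets are carried from the interval of p along X to the chosen
    -- interval. Equality of offsets is written additively to avoid truncated subtraction.
    refine component_induction (P := fun u => ∀ p' q', lo a b p' = lo a b u →
      lo a b q' = lo a b u → (p' : ℕ) + lo a b p = p + lo a b p' →
      (q' : ℕ) + lo a b q = q + lo a b q' → M p' q' = M p q) ?_ hp1 hv1 ?_ _ _ ?_ ?_ ?_ ?_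
    · intro c hc u _ ih p' q' hp' hq' hpp hqq
      have h2 : ∀ w, lo a b w = lo a b (blockReflection c u) →
          lo a b (shift a b c w) = lo a b u := by
        intro w hw
        rw [lo_shift hc, hi_eq_of_lo_eq hw, ← (lo_hi_blockReflection hc _).1,
          blockReflection_blockReflection]
      rw [← h1 c hc p' q' (hp'.trans hq'.symm)]
      have h3 := shift_add hc (a := a) (b := b) p'
      have h4 := shift_add hc (a := a) (b := b) q'
      exact ih _ _ (h2 _ hp') (h2 _ hq') (by omega) (by omega)
    · intro p' q' hp' hq' hpp hqq
      rw [lo_lo] at hp' hq'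
      have h2 : p' = p := by
        rw [hp'] at hpp
        ext
        omega
      have h3 : q' = q := by
        rw [hq', h] at hqq
        ext
        omega
      rw [h2, h3]
    · rw [lo_point, lo_lo]
    · rw [lo_point, lo_lo]
    · have h2 : (lo a b p : ℕ) ≤ p := lo_le p
      rw [lo_point]
      simp only [point, position]
      omega
    · have h2 : (lo a b q : ℕ) ≤ q := lo_le q
      rw [lo_point]
      simp only [point, position]
      omega
  · rw [blockMatrix_apply_of_ne _ h, h0 p q h]

theorem blockMatrix_mem_seaweed (f : BlockFamily a b) : blockMatrix f ∈ seaweed a b := by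
  intro p q h
  have h1 : lo a b p = lo a b q := by
    by_contra h1
    exact h (blockMatrix_apply_of_ne f h1)
  rw [← index_lo (a := a) (b := b) (Or.inl rfl) p, ← index_lo (a := a) (b := b) (Or.inr rfl) p,
    h1, index_lo (Or.inl rfl), index_lo (Or.inr rfl)]
  exact ⟨le_rfl, le_rfl⟩

variable (a b) in
/-- The homomorphism `blockMatrix` of monoids. -/
noncomputable def blockHom : BlockFamily a b →* Matrix (Fin n) (Fin n) ℂ where
  toFun := blockMatrix
  map_one' := blockMatrix_one
  map_mul' := blockMatrix_mul

variable (a b) in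
/-- The embedding of the product of the groups attached to the maximal cycles. -/
noncomputable def blockGL :
    (∀ X : MaximalCycle a b, GL (Fin (dimension X.1)) ℂ) →* GL (Fin n) ℂ :=
  (Units.map (blockHom a b)).comp MulEquiv.piUnits.symm.toMonoidHom

theorem coe_blockGL (g : ∀ X : MaximalCycle a b, GL (Fin (dimension X.1)) ℂ) :
    (blockGL a b g : Matrix (Fin n) (Fin n) ℂ) =
      blockMatrix fun X => (g X : Matrix (Fin (dimension X.1)) (Fin (dimension X.1)) ℂ) :=
  rfl

theorem blockGL_injective : Function.Injective (blockGL a b) := by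
  intro g h hgh
  have h1 := blockMatrix_injective (congrArg Units.val hgh)
  funext X
  exact Units.ext (congrFun h1 X)

variable (a b) in
open Classical in
/-- The embedding of the group attached to a maximal cycle. -/
noncomputable def cycleGL (X : MaximalCycle a b) : GL (Fin (dimension X.1)) ℂ →* GL (Fin n) ℂ :=
  (blockGL a b).comp 
    (MonoidHom.mulSingle (fun X : MaximalCycle a b => GL (Fin (dimension X.1)) ℂ) X)

open Classical in
theorem cycleGL_apply (X : MaximalCycle a b) (g : GL (Fin (dimension X.1)) ℂ) :
    cycleGL a b X g = blockGL a b (Pi.mulSingle X g) :=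
  rfl

theorem pairwise_commute_cycleGL :
    Pairwise fun X Y => ∀ g h, Commute (cycleGL a b X g) (cycleGL a b Y h) := by
  classical
  intro X Y hXY g h
  have h1 := Pi.mulSingle_commute (f := fun X : MaximalCycle a b => GL (Fin (dimension X.1)) ℂ)
    hXY g h
  rw [commute_iff_eq, cycleGL_apply, cycleGL_apply, ← map_mul, ← map_mul, h1.eq]

theorem noncommPiCoprod_cycleGL :
    MonoidHom.noncommPiCoprod (cycleGL a b) pairwise_commute_cycleGL = blockGL a b := by
  classical
  refine MonoidHom.pi_ext fun X g => ?_
  rw [MonoidHom.noncommPiCoprod_mulSingle]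
  rfl

theorem isDiagonalEmbedding_cycleGL (X : MaximalCycle a b) :
    IsDiagonalEmbedding X.1 (cycleGL a b X) := by
  classical
  have hlen : ∀ l h : Fin n, IsInterval X.1 l h → lo a b l = l ∧ hi a b l = h ∧
      maximalRoot a b l = X ∧ (h : ℕ) + 1 = l + dimension X.1 := by
    intro l h hi
    obtain ⟨h1, h2⟩ := lo_hi_eq X.2 hi le_rfl hi.le
    have h3 := root_eq X.2 hi le_rfl hi.le
    have h4 := hi_add_one (a := a) (b := b) l
    rw [h1, h2, h3] at h4
    exact ⟨h1, h2, Subtype.ext h3, h4⟩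
  have hcoe : ∀ g : GL (Fin (dimension X.1)) ℂ, (cycleGL a b X g : Matrix (Fin n) (Fin n) ℂ) =
      blockMatrix fun Y => ((Pi.mulSingle X g : ∀ Y : MaximalCycle a b,
        GL (Fin (dimension Y.1)) ℂ) Y : Matrix (Fin (dimension Y.1)) (Fin (dimension Y.1)) ℂ) :=
    fun g => rfl
  refine ⟨fun l h hi => (hlen l h hi).2.2.2, ?_, ?_⟩
  · intro l h hi g i j p q hp hq
    obtain ⟨h1, h2, h3, h4⟩ := hlen l h hi
    have hp' : p = point X l h3 i := by
      ext
      simp only [hp, point, h1]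
    have hq' : q = point X l h3 j := by
      ext
      simp only [hq, point, h1]
    rw [hcoe, hp', hq', blockMatrix_point, Pi.mulSingle_eq_same]
  · intro g p q hpq
    rw [hcoe]
    by_cases h : lo a b p = lo a b q
    · have hq := (maximalRoot_eq_of_lo_eq h).symm
      rw [blockMatrix_apply _ rfl hq h]
      have hne : maximalRoot a b p ≠ X := by
        intro hX
        refine hpq ⟨lo a b p, hi a b p, ?_, ⟨lo_le p, le_hi p⟩, ?_, ?_⟩
        · rw [← hX]
          exact isInterval_root p
        · exact h ▸ lo_le q
        · exact hi_eq_of_lo_eq h ▸ le_hi q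
      rw [Pi.mulSingle_eq_of_ne hne, Units.val_one, Matrix.one_apply, Matrix.one_apply]
      simp only [position_inj rfl hq h]
    · rw [blockMatrix_apply_of_ne _ h, Matrix.one_apply_ne]
      rintro rfl
      exact h rfl

end Block

/-! ### The linear form attached to the strands -/

section Form

variable {n : ℕ} {a b : Composition n} {c : Composition n}

variable (a b) in
/-- The matrix of the strands. -/
noncomputable def strandMatrix : Matrix (Fin n) (Fin n) ℂ := fun p q =>
  (if q = shift a b a p ∧ lo a b p < lo a b q then 1 else 0) +
    (if q = shift a b b p ∧ lo a b q < lo a b p then 1 else 0)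

variable (a b) in
/-- The linear form `x ↦ tr (F x)` on the seaweed algebra, for the matrix `F` of the strands. -/
noncomputable def strandForm : Module.Dual ℂ (seaweed a b) where
  toFun x := (strandMatrix a b * (x : Matrix (Fin n) (Fin n) ℂ)).trace
  map_add' x y := by simp [Matrix.mul_add]
  map_smul' z x := by simp

theorem strandForm_apply (x : seaweed a b) :
    strandForm a b x = (strandMatrix a b * (x : Matrix (Fin n) (Fin n) ℂ)).trace :=
  rfl

theorem shift_eq_iff (hc : c = a ∨ c = b) {p q : Fin n} :
    q = shift a b c p ↔ p = shift a b c q := by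
  constructor <;> rintro rfl <;> rw [shift_shift hc]

theorem strandMatrix_mul_apply (x : Matrix (Fin n) (Fin n) ℂ) (p q : Fin n) :
    (strandMatrix a b * x) p q =
      (if lo a b p < lo a b (shift a b a p) then x (shift a b a p) q else 0) +
      (if lo a b (shift a b b p) < lo a b p then x (shift a b b p) q else 0) := by
  simp only [Matrix.mul_apply, strandMatrix, add_mul, Finset.sum_add_distrib, ite_and, ite_mul,
    one_mul, zero_mul, Finset.sum_ite_eq', Finset.mem_univ, if_true]

theorem mul_strandMatrix_apply (x : Matrix (Fin n) (Fin n) ℂ) (p q : Fin n) :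
    (x * strandMatrix a b) p q =
      (if lo a b (shift a b a q) < lo a b q then x p (shift a b a q) else 0) +
      (if lo a b q < lo a b (shift a b b q) then x p (shift a b b q) else 0) := by
  simp only [Matrix.mul_apply, strandMatrix, mul_add, Finset.sum_add_distrib, ite_and, mul_ite,
    mul_one, mul_zero, shift_eq_iff (a := a) (b := b) (c := a) (Or.inl rfl) (q := q),
    shift_eq_iff (a := a) (b := b) (c := b) (Or.inr rfl) (q := q), Finset.sum_ite_eq',
    Finset.mem_univ, if_true]

theorem single_mem_seaweed {p q : Fin n} (ha : a.index p ≤ a.index q)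
    (hb : b.index q ≤ b.index p) (z : ℂ) : Matrix.single p q z ∈ seaweed a b := by
  intro i j h
  rw [Matrix.single_apply] at h
  split_ifs at h with h1
  · obtain ⟨rfl, rfl⟩ := h1
    exact ⟨ha, hb⟩
  · exact absurd rfl h

theorem lt_of_lo_lt {p q : Fin n} (h : lo a b p < lo a b q) : p < q :=
  lt_of_not_ge fun h' => (lo_mono h').not_gt h

/-- Testing against the matrix unit at (q, p) isolates the (p, q) entry of the commutator with F;
the hypotheses of `eqn` say that this unit belongs to the seaweed algebra. -/
theorem isKernel_of_trace {x : Matrix (Fin n) (Fin n) ℂ} (hx : x ∈ seaweed a b)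
    (h : ∀ y ∈ seaweed a b,
      (strandMatrix a b * (x * y)).trace = (strandMatrix a b * (y * x)).trace) :
    (strandSystem a b).IsKernel x where
  supp p q h1 h2 h3 := by
    by_contra h4
    obtain ⟨h5, h6⟩ := hx p q h4
    simp only [strandSystem, ne_eq, Nat.cast_inj, Nat.cast_lt, Fin.val_fin_lt, Fin.val_inj]
      at h1 h2 h3
    rcases lt_or_gt_of_ne h1 with h7 | h7
    · exact h2 h7 (le_antisymm (index_mono b (lt_of_lo_lt h7).le) h6)
    · exact h3 h7 (le_antisymm h5 (index_mono a (lt_of_lo_lt h7).le))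
  eqn p q h1 h2 := by
    simp only [strandSystem, Nat.cast_lt, Fin.val_fin_lt, Fin.val_inj] at h1 h2 ⊢
    have hmem : Matrix.single q p (1 : ℂ) ∈ seaweed a b := by
      rcases lt_trichotomy (lo a b p) (lo a b q) with h3 | h3 | h3
      · exact single_mem_seaweed (h1 h3).ge (index_mono b (lt_of_lo_lt h3).le) 1
      · refine single_mem_seaweed ?_ ?_ 1
        · rw [← index_lo (a := a) (b := b) (Or.inl rfl) p, h3, index_lo (Or.inl rfl)]
        · rw [← index_lo (a := a) (b := b) (Or.inr rfl) p, h3, index_lo (Or.inr rfl)]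
      · exact single_mem_seaweed (index_mono a (lt_of_lo_lt h3).le) (h2 h3).le 1
    have h3 := h _ hmem
    rw [← Matrix.mul_assoc, Matrix.trace_mul_single, Matrix.trace_mul_comm, Matrix.mul_assoc,
      Matrix.trace_single_mul, strandMatrix_mul_apply, mul_strandMatrix_apply, one_smul] at h3
    simpa using h3

theorem exists_blockMatrix_of_trace {x : Matrix (Fin n) (Fin n) ℂ} (hx : x ∈ seaweed a b)
    (h : ∀ y ∈ seaweed a b,
      (strandMatrix a b * (x * y)).trace = (strandMatrix a b * (y * x)).trace) :
    ∃ f : BlockFamily a b, blockMatrix f = x := by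
  have hk := isKernel_of_trace hx h
  refine exists_blockMatrix_eq (fun p q hpq => hk.eq_zero ?_) ?_
  · simpa [strandSystem, Fin.val_inj] using hpq
  · rintro c (rfl | rfl) p q hpq
    · exact hk.σ_apply (by simp [strandSystem, hpq])
    · exact hk.τ_apply (by simp [strandSystem, hpq])

theorem strandMatrix_mul_blockMatrix (f : BlockFamily a b) :
    strandMatrix a b * blockMatrix f = blockMatrix f * strandMatrix a b := by
  have key : ∀ c, c = a ∨ c = b → ∀ p q,
      blockMatrix f (shift a b c p) q = blockMatrix f p (shift a b c q) ∧
      (blockMatrix f p (shift a b c q) ≠ 0 →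
        lo a b p = lo a b (shift a b c q) ∧ lo a b (shift a b c p) = lo a b q) := by
    intro c hc p q
    have h : lo a b p = lo a b (shift a b c q) ↔ lo a b (shift a b c p) = lo a b q := by
      constructor <;> intro h
      · rw [lo_shift_eq hc h, shift_shift hc]
      · rw [← lo_shift_eq hc h, shift_shift hc]
    by_cases h1 : lo a b p = lo a b (shift a b c q)
    · refine ⟨?_, fun _ => ⟨h1, h.1 h1⟩⟩
      rw [← blockMatrix_shift hc f h1, shift_shift hc]
    · rw [blockMatrix_apply_of_ne f h1, blockMatrix_apply_of_ne f (mt h.2 h1)]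
      simp
  ext p q
  rw [strandMatrix_mul_apply, mul_strandMatrix_apply]
  obtain ⟨h1, h2⟩ := key a (Or.inl rfl) p q
  obtain ⟨h3, h4⟩ := key b (Or.inr rfl) p q
  rw [h1, h3]
  congr 1
  · by_cases h : blockMatrix f p (shift a b a q) = 0
    · rw [h, ite_self, ite_self]
    · rw [(h2 h).1, (h2 h).2]
  · by_cases h : blockMatrix f p (shift a b b q) = 0
    · rw [h, ite_self, ite_self]
    · rw [(h4 h).1, (h4 h).2]

/-- F only joins different intervals, where a block diagonal matrix vanishes. -/
theorem trace_strandMatrix_mul_blockMatrix (f : BlockFamily a b) :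
    (strandMatrix a b * blockMatrix f).trace = 0 := by
  refine Finset.sum_eq_zero fun p _ => ?_
  rw [Matrix.diag_apply, strandMatrix_mul_apply]
  split_ifs with h1 h2 h2
  · rw [blockMatrix_apply_of_ne f h1.ne', blockMatrix_apply_of_ne f h2.ne, add_zero]
  · rw [blockMatrix_apply_of_ne f h1.ne', add_zero]
  · rw [blockMatrix_apply_of_ne f h2.ne, add_zero]
  · rw [add_zero]

variable (a b) in
theorem isNilpotentType_strandForm : IsNilpotentType a b (strandForm a b) := by
  intro x hx
  obtain ⟨f, hf⟩ := exists_blockMatrix_of_trace x.2 fun y hy => by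
    have h := hx ⟨y, hy⟩
    rw [strandForm_apply, LieSubalgebra.coe_bracket, Ring.lie_def, Matrix.mul_sub,
      Matrix.trace_sub, sub_eq_zero] at h
    exact h
  rw [strandForm_apply, ← hf, trace_strandMatrix_mul_blockMatrix]

theorem strandForm_Ad_inv (g : seaweedGroup a b) (x : seaweed a b) :
    strandForm a b (Ad a b g⁻¹ x) = (strandMatrix a b *
      ((((g : GL (Fin n) ℂ)⁻¹ : GL (Fin n) ℂ) : Matrix (Fin n) (Fin n) ℂ) *
        (x : Matrix (Fin n) (Fin n) ℂ) * ((g : GL (Fin n) ℂ) : Matrix (Fin n) (Fin n) ℂ))).trace := by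
  rw [strandForm_apply]
  simp [Ad, conjMap]

theorem exists_blockMatrix_of_mem_stabiliser {g : seaweedGroup a b}
    (hg : g ∈ coadjointStabiliser a b (strandForm a b)) :
    ∃ f : BlockFamily a b, blockMatrix f = ((g : GL (Fin n) ℂ) : Matrix (Fin n) (Fin n) ℂ) := by
  refine exists_blockMatrix_of_trace g.2.1 fun y hy => ?_
  -- Evaluating the invariance at x = g y turns it into tr(F y g) = tr(F g y), which is linear in g.
  have h := hg ⟨_, mul_mem_seaweed g.2.1 hy⟩
  rw [strandForm_Ad_inv, strandForm_apply] at h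
  dsimp only at h
  rw [← h, ← Matrix.mul_assoc _ _ y, Units.inv_mul, Matrix.one_mul]

theorem mem_stabiliser_of_blockMatrix {g : seaweedGroup a b} {f : BlockFamily a b}
    (hf : blockMatrix f = ((g : GL (Fin n) ℂ) : Matrix (Fin n) (Fin n) ℂ)) :
    g ∈ coadjointStabiliser a b (strandForm a b) := by
  intro x
  rw [strandForm_Ad_inv, strandForm_apply, ← Matrix.mul_assoc, Matrix.trace_mul_comm,
    ← Matrix.mul_assoc, ← hf, ← strandMatrix_mul_blockMatrix, hf, Matrix.mul_assoc,
    ← Matrix.mul_assoc _ _ (x : Matrix (Fin n) (Fin n) ℂ), Units.mul_inv, Matrix.one_mul]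

theorem blockGL_mem_seaweedGroup (f : ∀ X : MaximalCycle a b, GL (Fin (dimension X.1)) ℂ) :
    blockGL a b f ∈ seaweedGroup a b := by
  refine ⟨blockMatrix_mem_seaweed _, ?_⟩
  rw [← map_inv]
  exact blockMatrix_mem_seaweed _

theorem exists_blockGL_of_mem_stabiliser {g : seaweedGroup a b}
    (hg : g ∈ coadjointStabiliser a b (strandForm a b)) : ∃ f, blockGL a b f = g := by
  obtain ⟨f, hf⟩ := exists_blockMatrix_of_mem_stabiliser hg
  obtain ⟨f', hf'⟩ := exists_blockMatrix_of_mem_stabiliser (inv_mem hg)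
  -- Applied to the inverse as well, the description gives block diagonal inverses, so every single
  -- block is invertible.
  have h1 : f * f' = 1 := blockMatrix_injective (by
    rw [blockMatrix_mul, hf, hf', blockMatrix_one, Subgroup.coe_inv, Units.mul_inv])
  have h2 : f' * f = 1 := blockMatrix_injective (by
    rw [blockMatrix_mul, hf, hf', blockMatrix_one, Subgroup.coe_inv, Units.inv_mul])
  refine ⟨fun X => ⟨f X, f' X, congrFun h1 X, congrFun h2 X⟩, Units.ext ?_⟩
  rw [coe_blockGL, ← hf]

theorem blockGL_mem_stabiliser (f : ∀ X : MaximalCycle a b, GL (Fin (dimension X.1)) ℂ) :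
    (⟨blockGL a b f, blockGL_mem_seaweedGroup f⟩ : seaweedGroup a b) ∈
      coadjointStabiliser a b (strandForm a b) :=
  mem_stabiliser_of_blockMatrix rfl

variable (a b) in
theorem map_stabiliser_eq_range :
    (coadjointStabiliser a b (strandForm a b)).map (seaweedGroup a b).subtype =
      (blockGL a b).range := by
  ext g
  constructor
  · rintro ⟨g, hg, rfl⟩
    exact exists_blockGL_of_mem_stabiliser hg
  · rintro ⟨f, rfl⟩
    exact ⟨⟨blockGL a b f, blockGL_mem_seaweedGroup f⟩, blockGL_mem_stabiliser f, rfl⟩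

/-- The centre of a seaweed algebra consists of semisimple elements. -/
theorem isSemisimple_of_mem_center {x : seaweed a b} (hx : x ∈ LieAlgebra.center ℂ (seaweed a b)) :
    Module.End.IsSemisimple (Matrix.toLin' (x : Matrix (Fin n) (Fin n) ℂ)) := by
  -- All diagonal matrix units belong to the algebra, and commuting with them forces a matrix to be
  -- diagonal.
  have hdiag : ∀ p q, p ≠ q → (x : Matrix (Fin n) (Fin n) ℂ) p q = 0 := by
    intro p q hpq
    rw [LieModule.mem_maxTrivSubmodule] at hx
    have h := congrArg Subtype.val
      (hx ⟨Matrix.single p p 1, single_mem_seaweed le_rfl le_rfl 1⟩)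
    rw [LieSubalgebra.coe_bracket, Ring.lie_def] at h
    have h1 := congrFun (congrFun h p) q
    simpa [hpq, Matrix.mul_single_apply_of_ne _ _ _ _ _ hpq.symm] using h1
  set d : Fin n → ℂ := fun p => (x : Matrix (Fin n) (Fin n) ℂ) p p
  have hx' : (x : Matrix (Fin n) (Fin n) ℂ) = Matrix.diagonal d := by
    ext p q
    by_cases h : p = q
    · subst h
      rw [Matrix.diagonal_apply_eq]
    · rw [Matrix.diagonal_apply_ne _ h, hdiag p q h]
  rw [hx']
  -- The image discards repeated diagonal entries, so the product is squarefree while still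
  -- annihilating the matrix.
  let P : Polynomial ℂ := ∏ z ∈ Finset.univ.image d, (Polynomial.X - Polynomial.C z)
  have hP : Squarefree P :=
    (Polynomial.separable_prod_X_sub_C_iff'.2 fun _ _ _ _ h => h).squarefree
  refine Module.End.isSemisimple_of_squarefree_aeval_eq_zero hP ?_
  have h1 : Polynomial.aeval (Matrix.toLin' (Matrix.diagonal d)) P =
      Matrix.toLin' (Polynomial.aeval (Matrix.diagonal d) P) :=
    (Polynomial.aeval_algHom_apply (Matrix.toLinAlgEquiv' : _ ≃ₐ[ℂ] _).toAlgHom _ P)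
  have h2 : Polynomial.aeval (Matrix.diagonal d) P =
      Matrix.diagonal (Polynomial.aeval d P) :=
    (Polynomial.aeval_algHom_apply (Matrix.diagonalAlgHom ℂ) d P)
  have h3 : Polynomial.aeval d P = 0 := by
    funext p
    rw [Polynomial.aeval_pi_apply₂ (A := fun _ : Fin n => ℂ)]
    refine (map_prod _ _ _).trans ?_
    exact Finset.prod_eq_zero (Finset.mem_image_of_mem d (Finset.mem_univ p)) (by simp)
  rw [h1, h2, h3]
  simp

end Form

/-! ### Conjugations which are unipotent -/

section Conjugation

variable {m : Type*} [Fintype m]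

theorem trace_vecMulVec_mul (x f : m → ℂ) (M : Matrix m m ℂ) :
    (vecMulVec x f * M).trace = f ⬝ᵥ M *ᵥ x := by
  rw [vecMulVec_mul, trace_vecMulVec, dotProduct_comm, dotProduct_mulVec]

variable [DecidableEq m]

/-- The linear map `M ↦ k M k'` on matrices. -/
def conjugation (k k' : Matrix m m ℂ) : Matrix m m ℂ →ₗ[ℂ] Matrix m m ℂ :=
  LinearMap.mulLeft ℂ k ∘ₗ LinearMap.mulRight ℂ k'

theorem conjugation_apply (k k' M : Matrix m m ℂ) : conjugation k k' M = k * (M * k') :=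
  rfl

theorem trace_conjugation (k k' : Matrix m m ℂ) :
    LinearMap.trace ℂ _ (conjugation k k') = k.trace * k'.trace := by
  rw [LinearMap.trace_eq_matrix_trace ℂ (Matrix.stdBasis ℂ m m), Matrix.trace, Matrix.trace,
    Matrix.trace, Finset.sum_mul_sum, Fintype.sum_prod_type]
  refine Finset.sum_congr rfl fun i _ => Finset.sum_congr rfl fun j _ => ?_
  have hrepr : ∀ M : Matrix m m ℂ, (Matrix.stdBasis ℂ m m).repr M (i, j) = M i j := fun M => rfl
  rw [Matrix.diag_apply, LinearMap.toMatrix_apply, hrepr, Matrix.stdBasis_eq_single,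
    conjugation_apply, Matrix.diag_apply, Matrix.diag_apply]
  simp [Matrix.mul_apply, Matrix.single_apply, Finset.sum_ite_eq, ite_and]

/-- A unipotent map has trace equal to the dimension of the space, here that of the matrix algebra.
-/
theorem trace_mul_trace_of_isNilpotent {k k' : Matrix m m ℂ}
    (h : IsNilpotent (conjugation k k' - 1)) :
    k.trace * k'.trace = (Fintype.card m : ℂ) * Fintype.card m := by
  have h1 := (LinearMap.isNilpotent_trace_of_isNilpotent h).eq_zero
  rw [map_sub, trace_conjugation, LinearMap.trace_one, Module.finrank_matrix] at h1
  simpa [sub_eq_zero] using h1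

/-- The transvection `1 + z x fᵗ`, where `fᵗ x = 0`. -/
def transvectionGL (x f : m → ℂ) (h : f ⬝ᵥ x = 0) (z : ℂ) : GL m ℂ where
  val := 1 + z • vecMulVec x f
  inv := 1 - z • vecMulVec x f
  val_inv := by
    have h1 : vecMulVec x f * vecMulVec x f = 0 := by
      rw [vecMulVec_mul_vecMulVec, h]
      simp
    simp [add_mul, mul_sub, h1]
  inv_val := by
    have h1 : vecMulVec x f * vecMulVec x f = 0 := by
      rw [vecMulVec_mul_vecMulVec, h]
      simp
    simp [sub_mul, mul_add, h1]

/-- With E = x fᵗ, the terms linear in z have trace tr E = 0, and E G E is a scalar multiple of E;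
only the quadratic term survives. -/
theorem trace_commutator_transvectionGL (x f : m → ℂ) (h : f ⬝ᵥ x = 0) (z : ℂ) (g : GL m ℂ) :
    ((transvectionGL x f h z * g * (transvectionGL x f h z)⁻¹ * g⁻¹ : GL m ℂ) :
      Matrix m m ℂ).trace = Fintype.card m -
        z ^ 2 * ((f ⬝ᵥ (g : Matrix m m ℂ) *ᵥ x) *
          (f ⬝ᵥ ((g⁻¹ : GL m ℂ) : Matrix m m ℂ) *ᵥ x)) := by
  have h0 : (vecMulVec x f).trace = 0 := by rw [trace_vecMulVec, dotProduct_comm, h]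
  have hinv : (((transvectionGL x f h z)⁻¹ : GL m ℂ) : Matrix m m ℂ) = 1 - z • vecMulVec x f := rfl
  have hval : ((transvectionGL x f h z : GL m ℂ) : Matrix m m ℂ) = 1 + z • vecMulVec x f := rfl
  have hE : ∀ M : Matrix m m ℂ, vecMulVec x f * M * vecMulVec x f =
      (f ⬝ᵥ M *ᵥ x) • vecMulVec x f := by
    intro M
    rw [vecMulVec_mul, vecMulVec_mul_vecMulVec, ← dotProduct_mulVec, vecMulVec_smul]
  have h1 : (g : Matrix m m ℂ) * ((g⁻¹ : GL m ℂ) : Matrix m m ℂ) = 1 := Units.mul_inv g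
  have h2 : ((g⁻¹ : GL m ℂ) : Matrix m m ℂ) * (g : Matrix m m ℂ) = 1 := Units.inv_mul g
  rw [Units.val_mul, Units.val_mul, Units.val_mul, hinv, hval]
  generalize (g : Matrix m m ℂ) = G at *
  generalize ((g⁻¹ : GL m ℂ) : Matrix m m ℂ) = G' at *
  generalize hV : vecMulVec x f = E at *
  have h3 : (1 + z • E) * G * (1 - z • E) * G' =
      G * G' + z • (E * (G * G')) - z • (G * E * G') - (z * z) • ((E * G * E) * G') := by
    simp only [add_mul, mul_sub, mul_one, one_mul, sub_mul, smul_mul_assoc, mul_smul_comm,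
      smul_smul, smul_add, Matrix.mul_assoc]
    abel
  rw [h3, h1, hE, mul_one, Matrix.trace_sub, Matrix.trace_sub, Matrix.trace_add, Matrix.trace_smul,
    Matrix.trace_smul, Matrix.trace_smul, Matrix.trace_mul_cycle, h2, one_mul, h0,
    Matrix.smul_mul, Matrix.trace_smul, ← hV, trace_vecMulVec_mul, Matrix.trace_one]
  simp only [smul_eq_mul]
  ring

/-- The inverse is conjugate to the same commutator formed with g⁻¹, and the trace formula is
symmetric in g and g⁻¹. -/
theorem inv_commutator_trace (x f : m → ℂ) (h : f ⬝ᵥ x = 0) (z : ℂ) (g : GL m ℂ) :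
    (((transvectionGL x f h z * g * (transvectionGL x f h z)⁻¹ * g⁻¹)⁻¹ : GL m ℂ) :
      Matrix m m ℂ).trace = Fintype.card m -
        z ^ 2 * ((f ⬝ᵥ (g : Matrix m m ℂ) *ᵥ x) *
          (f ⬝ᵥ ((g⁻¹ : GL m ℂ) : Matrix m m ℂ) *ᵥ x)) := by
  have h1 : (transvectionGL x f h z * g * (transvectionGL x f h z)⁻¹ * g⁻¹)⁻¹ =
      g * (transvectionGL x f h z * g⁻¹ * (transvectionGL x f h z)⁻¹ * g⁻¹⁻¹) * g⁻¹ := by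
    group
  rw [h1, Units.val_mul, Units.val_mul, Matrix.trace_mul_cycle, Units.inv_mul, one_mul,
    trace_commutator_transvectionGL, inv_inv]
  ring

/-- If v and g v are independent, then so are v and g⁻¹ v. One functional vanishing at v but not at
g v, and another vanishing at v but not at g⁻¹ v, must each annihilate the other vector, and their
sum violates the hypothesis. So every vector is an eigenvector. -/
theorem eq_smul_one_of_forall_dual {g g' : Matrix m m ℂ} (hg : g * g' = 1)
    (h : ∀ (x : m → ℂ) (φ : Module.Dual ℂ (m → ℂ)), φ x = 0 →
      φ (g *ᵥ x) * φ (g' *ᵥ x) = 0) : ∃ z : ℂ, g = z • 1 := by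
  have hdual : ∀ {x y : m → ℂ}, LinearIndependent ℂ ![x, y] →
      ∃ φ : Module.Dual ℂ (m → ℂ), φ x = 0 ∧ φ y ≠ 0 := by
    intro x y hxy
    have hx : x ≠ 0 := hxy.ne_zero 0
    have hy : y ∉ Submodule.span ℂ {x} := by
      rw [Submodule.mem_span_singleton]
      rintro ⟨z, hz⟩
      exact (LinearIndependent.pair_iff' hx).1 hxy z hz
    obtain ⟨φ, h1, h2⟩ := Submodule.exists_le_ker_of_notMem hy
    exact ⟨φ, h2 (Submodule.mem_span_singleton_self x), h1⟩
  obtain ⟨z, hz⟩ := LinearMap.exists_eq_smul_id_of_forall_notLinearIndependent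
    (f := Matrix.toLin' g) (by
      intro v hv
      rw [Matrix.toLin'_apply] at hv
      have hv' : LinearIndependent ℂ ![v, g' *ᵥ v] := by
        rw [LinearIndependent.pair_iff] at hv ⊢
        intro s t hst
        have h1 := congrArg (g *ᵥ ·) hst
        simp only [mulVec_add, mulVec_smul, mulVec_mulVec, hg, one_mulVec, mulVec_zero] at h1
        rw [add_comm] at h1
        exact (hv t s h1).symm
      obtain ⟨φ, h1, h2⟩ := hdual hv
      obtain ⟨ψ, h3, h4⟩ := hdual hv'
      have h5 := (mul_eq_zero.1 (h v φ h1)).resolve_left h2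
      have h6 := (mul_eq_zero.1 (h v ψ h3)).resolve_right h4
      have h7 := h v (φ + ψ) (by rw [LinearMap.add_apply, h1, h3, add_zero])
      rw [LinearMap.add_apply, LinearMap.add_apply, h5, h6, add_zero, zero_add] at h7
      exact (mul_ne_zero h2 h4) h7)
  refine ⟨z, ?_⟩
  apply Matrix.toLin'.injective
  rw [hz, map_smul, Matrix.toLin'_one]
  rfl

/-- A matrix whose commutators with all transvections act unipotently by conjugation is scalar. -/
theorem eq_smul_one_of_isNilpotent (g : GL m ℂ)
    (h : ∀ t : GL m ℂ, IsNilpotent (conjugation ((t * g * t⁻¹ * g⁻¹ : GL m ℂ) : Matrix m m ℂ)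
      (((t * g * t⁻¹ * g⁻¹)⁻¹ : GL m ℂ) : Matrix m m ℂ) - 1)) :
    ∃ z : ℂ, (g : Matrix m m ℂ) = z • 1 := by
  refine eq_smul_one_of_forall_dual (Units.mul_inv g) fun x φ hφ => ?_
  let f : m → ℂ := fun i => φ (Pi.single i 1)
  have hf : ∀ y, φ y = f ⬝ᵥ y := by
    intro y
    rw [LinearMap.pi_apply_eq_sum_univ φ y, dotProduct]
    refine Finset.sum_congr rfl fun i _ => ?_
    have h1 : (fun j => if i = j then (1 : ℂ) else 0) = Pi.single i 1 := by
      funext j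
      simp [Pi.single_apply, eq_comm]
    rw [h1, smul_eq_mul, mul_comm]
  have hfx : f ⬝ᵥ x = 0 := by rw [← hf, hφ]
  rw [hf, hf]
  set s := (f ⬝ᵥ (g : Matrix m m ℂ) *ᵥ x) * (f ⬝ᵥ ((g⁻¹ : GL m ℂ) : Matrix m m ℂ) *ᵥ x)
    with hs
  by_contra hne
  -- Unipotence gives (r - z²s)² = r² for the size r. A nonzero s would have to be 2r for z = 1 and
  -- r/2 for z = 2, which is possible only for s = 0.
  have h1 := trace_mul_trace_of_isNilpotent (h (transvectionGL x f hfx 1))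
  have h2 := trace_mul_trace_of_isNilpotent (h (transvectionGL x f hfx 2))
  rw [trace_commutator_transvectionGL, inv_commutator_trace, ← hs] at h1 h2
  have h3 : s * (s - 2 * Fintype.card m) = 0 := by linear_combination h1
  have h4 : s * (2 * s - Fintype.card m) = 0 := by linear_combination h2 / 8
  have h5 := (mul_eq_zero.1 h3).resolve_left hne
  have h6 := (mul_eq_zero.1 h4).resolve_left hne
  exact hne (by linear_combination (2 * h6 - h5) / 3)

end Conjugation

/-! ### The strand form is of reductive type -/

section Reductive

variable {n : ℕ} {a b : Composition n}

/-- The element of the seaweed group attached to elements of the groups of the maximal cycles. -/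
noncomputable def blockSeaweed (f : ∀ X : MaximalCycle a b, GL (Fin (dimension X.1)) ℂ) :
    seaweedGroup a b :=
  ⟨blockGL a b f, blockGL_mem_seaweedGroup f⟩

theorem blockSeaweed_mul (f g : ∀ X : MaximalCycle a b, GL (Fin (dimension X.1)) ℂ) :
    blockSeaweed (f * g) = blockSeaweed f * blockSeaweed g :=
  Subtype.ext (map_mul _ _ _)

theorem blockSeaweed_inv (f : ∀ X : MaximalCycle a b, GL (Fin (dimension X.1)) ℂ) :
    blockSeaweed f⁻¹ = (blockSeaweed f)⁻¹ :=
  Subtype.ext (map_inv _ _)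

theorem coe_Ad_apply (g : seaweedGroup a b) (x : seaweed a b) :
    ((Ad a b g x : seaweed a b) : Matrix (Fin n) (Fin n) ℂ) =
      ((g : GL (Fin n) ℂ) : Matrix (Fin n) (Fin n) ℂ) * (x : Matrix (Fin n) (Fin n) ℂ) *
        (((g : GL (Fin n) ℂ)⁻¹ : GL (Fin n) ℂ) : Matrix (Fin n) (Fin n) ℂ) :=
  rfl

open Classical in
/-- The block diagonal matrices with equal blocks over the intervals of `X` only. -/
noncomputable def singleBlock (X : MaximalCycle a b) :
    Matrix (Fin (dimension X.1)) (Fin (dimension X.1)) ℂ →ₗ[ℂ] seaweed a b where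
  toFun M := ⟨blockMatrix (Pi.single X M : BlockFamily a b), blockMatrix_mem_seaweed _⟩
  map_add' M N := Subtype.ext ((congrArg blockMatrix (Pi.single_add X M N)).trans
    (blockMatrix_add _ _))
  map_smul' z M := Subtype.ext ((congrArg blockMatrix (Pi.single_smul X z M)).trans
    (blockMatrix_smul _ _))

theorem singleBlock_injective (X : MaximalCycle a b) : Function.Injective (singleBlock X) := by
  classical
  intro M N h
  exact Pi.single_injective X (blockMatrix_injective (congrArg Subtype.val h))

theorem Ad_blockSeaweed_singleBlock (f : ∀ X : MaximalCycle a b, GL (Fin (dimension X.1)) ℂ)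
    (X : MaximalCycle a b) (M : Matrix (Fin (dimension X.1)) (Fin (dimension X.1)) ℂ) :
    Ad a b (blockSeaweed f) (singleBlock X M) =
      singleBlock X (conjugation (f X).1 (f X)⁻¹.1 M) := by
  classical
  apply Subtype.ext
  rw [coe_Ad_apply]
  change blockMatrix _ * blockMatrix _ * ((blockGL a b f)⁻¹ : GL (Fin n) ℂ).val = blockMatrix _
  rw [← map_inv, coe_blockGL, ← blockMatrix_mul, ← blockMatrix_mul]
  congr 1
  funext Y
  by_cases h : Y = X
  · subst h
    simp [conjugation_apply, Matrix.mul_assoc]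
  · simp [Pi.single_eq_of_ne h]

/-- The matrices supported over the intervals of one maximal cycle form a subspace of the algebra
stable under the stabiliser; unipotence is restricted to it. -/
theorem isNilpotent_conjugation {f : ∀ X : MaximalCycle a b, GL (Fin (dimension X.1)) ℂ}
    (h : IsNilpotent ((Ad a b (blockSeaweed f) : seaweed a b →ₗ[ℂ] seaweed a b) - 1))
    (X : MaximalCycle a b) :
    IsNilpotent (conjugation (f X).1 (f X)⁻¹.1 - 1) := by
  obtain ⟨k, hk⟩ := h
  refine ⟨k, LinearMap.ext fun M => singleBlock_injective X ?_⟩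
  have key : ∀ (k : ℕ) M,
      (((Ad a b (blockSeaweed f) : seaweed a b →ₗ[ℂ] seaweed a b) - 1) ^ k) (singleBlock X M) =
      singleBlock X (((conjugation (f X).1 (f X)⁻¹.1 - 1) ^ k) M) := by
    intro k
    induction k with
    | zero => intro M; rfl
    | succ k ih =>
      intro M
      rw [pow_succ, pow_succ, Module.End.mul_apply, Module.End.mul_apply, ← ih]
      congr 1
      rw [LinearMap.sub_apply, LinearMap.sub_apply, map_sub]
      exact congrArg₂ (· - ·) (Ad_blockSeaweed_singleBlock f X M) rfl
  rw [← key, hk, LinearMap.zero_apply, LinearMap.zero_apply, map_zero]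

theorem exists_blockSeaweed_eq {g : seaweedGroup a b}
    (hg : g ∈ coadjointStabiliser a b (strandForm a b)) : ∃ f, blockSeaweed f = g := by
  obtain ⟨f, hf⟩ := exists_blockGL_of_mem_stabiliser hg
  exact ⟨f, Subtype.ext hf⟩

/-- A diagonal element scales the entry at (p, q) by d_p / d_q. Wherever the algebra has a nonzero
entry, nilpotence of d_p / d_q - 1 makes this factor equal to 1. -/
theorem Ad_eq_one_of_diagonal {g : seaweedGroup a b} {d : Fin n → ℂ}
    (hg : ((g : GL (Fin n) ℂ) : Matrix (Fin n) (Fin n) ℂ) = Matrix.diagonal d)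
    (h : IsNilpotent ((Ad a b g : seaweed a b →ₗ[ℂ] seaweed a b) - 1)) : Ad a b g = 1 := by
  have h1 : ∀ p q, d p * (((g : GL (Fin n) ℂ)⁻¹ : GL (Fin n) ℂ) : Matrix (Fin n) (Fin n) ℂ) p q =
      (1 : Matrix (Fin n) (Fin n) ℂ) p q := by
    intro p q
    rw [← Matrix.diagonal_mul, ← hg, Units.mul_inv]
  have hd : ∀ p, d p ≠ 0 := fun p hp => by simpa [hp] using h1 p p
  have hinv : (((g : GL (Fin n) ℂ)⁻¹ : GL (Fin n) ℂ) : Matrix (Fin n) (Fin n) ℂ) =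
      Matrix.diagonal fun p => (d p)⁻¹ := by
    ext p q
    have h2 := h1 p q
    by_cases hpq : p = q
    · subst hpq
      rw [Matrix.one_apply_eq] at h2
      rw [Matrix.diagonal_apply_eq]
      exact eq_inv_of_mul_eq_one_right h2
    · rw [Matrix.one_apply_ne hpq] at h2
      rw [Matrix.diagonal_apply_ne _ hpq]
      exact (mul_eq_zero.1 h2).resolve_left (hd p)
  have happly : ∀ (x : seaweed a b) p q,
      ((Ad a b g x : seaweed a b) : Matrix (Fin n) (Fin n) ℂ) p q =
        d p * (x : Matrix (Fin n) (Fin n) ℂ) p q * (d q)⁻¹ := by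
    intro x p q
    rw [coe_Ad_apply, hg, hinv, Matrix.mul_diagonal, Matrix.diagonal_mul]
  obtain ⟨k, hk⟩ := h
  have hpow : ∀ (k : ℕ) (x : seaweed a b) p q,
      (((((Ad a b g : seaweed a b →ₗ[ℂ] seaweed a b) - 1) ^ k) x : seaweed a b) :
        Matrix (Fin n) (Fin n) ℂ) p q =
        (d p * (d q)⁻¹ - 1) ^ k * (x : Matrix (Fin n) (Fin n) ℂ) p q := by
    intro k
    induction k with
    | zero => intro x p q; simp
    | succ k ih =>
      intro x p q
      rw [pow_succ, Module.End.mul_apply, ih, pow_succ, mul_assoc]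
      congr 1
      have h2 : ((((Ad a b g : seaweed a b →ₗ[ℂ] seaweed a b) - 1) x : seaweed a b) :
          Matrix (Fin n) (Fin n) ℂ) p q =
          ((Ad a b g x : seaweed a b) : Matrix (Fin n) (Fin n) ℂ) p q -
            (x : Matrix (Fin n) (Fin n) ℂ) p q := rfl
      rw [h2, happly]
      ring
  ext x p q
  change ((Ad a b g x : seaweed a b) : Matrix (Fin n) (Fin n) ℂ) p q =
    (x : Matrix (Fin n) (Fin n) ℂ) p q
  rw [happly]
  by_cases hx : (x : Matrix (Fin n) (Fin n) ℂ) p q = 0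
  · rw [hx, mul_zero, zero_mul]
  · have h2 := hpow k x p q
    rw [hk] at h2
    have h4 : d p * (d q)⁻¹ - 1 = 0 := by
      have h5 := (mul_eq_zero.1 h2.symm).resolve_right hx
      exact eq_zero_of_pow_eq_zero h5
    linear_combination (x : Matrix (Fin n) (Fin n) ℂ) p q * h4

theorem blockMatrix_eq_diagonal {f : BlockFamily a b} {z : MaximalCycle a b → ℂ}
    (h : ∀ X, f X = z X • 1) :
    blockMatrix f = Matrix.diagonal fun p => z (maximalRoot a b p) := by
  ext p q
  by_cases hlo : lo a b p = lo a b q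
  · have hq := (maximalRoot_eq_of_lo_eq hlo).symm
    rw [blockMatrix_apply f rfl hq hlo, h, Matrix.smul_apply, Matrix.one_apply,
      Matrix.diagonal_apply]
    simp only [position_inj rfl hq hlo]
    simp
  · rw [blockMatrix_apply_of_ne f hlo, Matrix.diagonal_apply_ne]
    rintro rfl
    exact hlo rfl

variable (a b) in
theorem isReductiveType_strandForm : IsReductiveType a b (strandForm a b) := by
  classical
  intro N hN hnormal hunip
  rw [Subgroup.eq_bot_iff_forall]
  intro u hu
  obtain ⟨g, hg, rfl⟩ := hN hu
  obtain ⟨f, rfl⟩ := exists_blockSeaweed_eq hg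
  have hscalar : ∀ X, ∃ z : ℂ,
      (f X : Matrix (Fin (dimension X.1)) (Fin (dimension X.1)) ℂ) = z • 1 := by
    intro X
    refine eq_smul_one_of_isNilpotent (f X) fun t => ?_
    let h : ∀ X : MaximalCycle a b, GL (Fin (dimension X.1)) ℂ := Pi.mulSingle X t
    -- The commutator with an element of a single factor is the product of a conjugate of u and its
    -- inverse, so it remains in N and acts unipotently.
    have h1 : Ad a b (blockSeaweed h) * Ad a b (blockSeaweed f) * (Ad a b (blockSeaweed h))⁻¹ *
        (Ad a b (blockSeaweed f))⁻¹ ∈ N :=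
      mul_mem (hnormal _ (Subgroup.mem_map_of_mem _ (blockGL_mem_stabiliser h)) _ hu) (inv_mem hu)
    rw [← map_inv, ← map_inv, ← map_mul, ← map_mul, ← map_mul, ← blockSeaweed_inv,
      ← blockSeaweed_inv, ← blockSeaweed_mul, ← blockSeaweed_mul, ← blockSeaweed_mul] at h1
    have h2 := isNilpotent_conjugation (hunip _ h1) X
    simpa [h] using h2
  choose z hz using hscalar
  exact Ad_eq_one_of_diagonal (blockMatrix_eq_diagonal hz) (hunip _ hu)

end Reductive

/-! ### Connectedness of the stabiliser -/

section Connected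

theorem finite_det_one_add_smul {m : Type*} [Fintype m] [DecidableEq m] (M : Matrix m m ℂ) :
    {z : ℂ | (1 + z • M).det = 0}.Finite := by
  let P : Polynomial ℂ := (1 + (Polynomial.X : Polynomial ℂ) • M.map Polynomial.C).det
  have hP : ∀ z, P.eval z = (1 + z • M).det := by
    intro z
    rw [← Polynomial.coe_evalRingHom, RingHom.map_det]
    congr 1
    ext i j
    by_cases h : i = j
    · subst h
      simp
      ring
    · simp [Matrix.one_apply_ne h]
      ring
  have hne : P ≠ 0 := by
    intro h
    have := hP 0
    simp [h] at this
  refine (P.roots.toFinset.finite_toSet).subset fun z hz => ?_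
  simp only [Finset.mem_coe, Multiset.mem_toFinset]
  exact (Polynomial.mem_roots hne).2 ((hP z).trans hz)

/-- The complex line through 1 and g meets the singular matrices in finitely many points, and the
plane without a finite set is connected. -/
instance preconnectedSpace_GL (r : ℕ) : PreconnectedSpace (GL (Fin r) ℂ) := by
  refine ⟨isPreconnected_of_forall 1 fun g _ => ?_⟩
  set M : Matrix (Fin r) (Fin r) ℂ := g.1 - 1
  set U : Set ℂ := {z : ℂ | (1 + z • M).det = 0}ᶜ
  have hU : IsPreconnected U :=
    ((finite_det_one_add_smul M).countable.isConnected_compl_of_one_lt_rank (by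
      rw [Complex.rank_real_complex]
      exact Nat.one_lt_ofNat)).isPreconnected
  have : PreconnectedSpace U := isPreconnected_iff_preconnectedSpace.1 hU
  let φ : U → GL (Fin r) ℂ := fun z => Matrix.GeneralLinearGroup.mkOfDetNeZero (1 + z.1 • M) z.2
  have hval : Continuous fun z : U => 1 + z.1 • M := by fun_prop
  have hφ : Continuous φ := by
    refine Units.continuous_iff.2 ⟨hval, ?_⟩
    have h1 : (fun z : U => ((φ z)⁻¹ : GL (Fin r) ℂ).1) =
        fun z : U => ((1 + z.1 • M).det)⁻¹ • (1 + z.1 • M).adjugate := by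
      funext z
      rw [Matrix.coe_units_inv, Matrix.inv_def, Ring.inverse_eq_inv']
      rfl
    rw [h1]
    exact (hval.matrix_det.inv₀ fun z => z.2).smul hval.matrix_adjugate
  refine ⟨Set.range φ, Set.subset_univ _, ⟨⟨0, by simp [U]⟩, ?_⟩, ⟨⟨1, ?_⟩, ?_⟩,
    isPreconnected_range hφ⟩
  · apply Units.ext
    change 1 + (0 : ℂ) • M = 1
    simp
  · have : IsUnit g.1.det := (Matrix.isUnit_iff_isUnit_det _).1 g.isUnit
    simpa [U, M] using this.ne_zero
  · apply Units.ext
    change 1 + (1 : ℂ) • M = g.1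
    simp [M]

variable {n : ℕ} {a b : Composition n}

theorem continuous_blockMatrix : Continuous (blockMatrix : BlockFamily a b → _) := by
  refine continuous_matrix fun p q => ?_
  by_cases h : lo a b p = lo a b q
  · have hq := (maximalRoot_eq_of_lo_eq h).symm
    simp only [fun f : BlockFamily a b => blockMatrix_apply f rfl hq h]
    exact (continuous_apply (maximalRoot a b p)).matrix_elem _ _
  · simp only [fun f : BlockFamily a b => blockMatrix_apply_of_ne f h]
    exact continuous_const

variable (a b) in
theorem continuous_blockGL : Continuous (blockGL a b) := by
  have hval : Continuous fun f => (blockGL a b f).1 :=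
    continuous_blockMatrix.comp (continuous_pi fun X =>
      Units.continuous_val.comp (continuous_apply X))
  refine Units.continuous_iff.2 ⟨hval, ?_⟩
  have h : (fun f => ((blockGL a b f)⁻¹ : GL (Fin n) ℂ).1) = fun f => (blockGL a b f⁻¹).1 := by
    funext f
    rw [map_inv]
  rw [h]
  exact hval.comp continuous_inv

variable (a b) in
theorem isConnected_range_blockGL :
    IsConnected ((blockGL a b).range : Set (GL (Fin n) ℂ)) := by
  rw [MonoidHom.coe_range]
  exact ⟨Set.range_nonempty _, isPreconnected_range (continuous_blockGL a b)⟩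

end Connected

end SeaweedMRS

theorem theorem4p3 (n : ℕ) (a b : Composition n) :
    (∀ X : SeaweedMRS.MaximalCycle a b, SeaweedMRS.IsCycle X.1 → Even X.1.supp.ncard) ∧
    ∃ (ι : ∀ X : SeaweedMRS.MaximalCycle a b,
        GL (Fin (SeaweedMRS.dimension X.1)) ℂ →* GL (Fin n) ℂ)
      (hcomm : Pairwise fun X Y => ∀ g h, Commute (ι X g) (ι Y h)),
      (∀ X, SeaweedMRS.IsDiagonalEmbedding X.1 (ι X)) ∧
      Function.Injective (MonoidHom.noncommPiCoprod ι hcomm) ∧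
      SeaweedMRS.IsMaximalReductiveStabiliser a b (MonoidHom.noncommPiCoprod ι hcomm).range ∧
      IsConnected ((MonoidHom.noncommPiCoprod ι hcomm).range : Set (GL (Fin n) ℂ)) := by
  refine ⟨fun X hX => hX.even_ncard, SeaweedMRS.cycleGL a b, SeaweedMRS.pairwise_commute_cycleGL,
    SeaweedMRS.isDiagonalEmbedding_cycleGL, ?_⟩
  rw [SeaweedMRS.noncommPiCoprod_cycleGL]
  exact ⟨SeaweedMRS.blockGL_injective,
    ⟨⟨⟨_, SeaweedMRS.isReductiveType_strandForm a b⟩,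
      fun _ => SeaweedMRS.isSemisimple_of_mem_center⟩,
      _, SeaweedMRS.isReductiveType_strandForm a b, SeaweedMRS.isNilpotentType_strandForm a b,
      (SeaweedMRS.map_stabiliser_eq_range a b).symm⟩,
    SeaweedMRS.isConnected_range_blockGL a b⟩
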